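/- Let $n,k\ge 0$. On the phase space $\mathbb R^{2n}=\{X=(P,Q): P,Q\in\mathbb R^n\}$ let $\omega(X,X')=\sum_j(P_jQ_j'-P_j'Q_j)$, and let $\Omega(X)=\sum_j\bigl(P_j\xi_j-Q_j\tfrac1i\tfrac{\partial}{\partial\xi_j}\bigr)$, so that $(e^{i\Omega(P,Q)}\psi)(\xi)=e^{i(P\cdot\xi-P\cdot Q/2)}\psi(\xi-Q)$; this operator acts on $\mathcal S(\mathbb R^n)$ and, by duality, on $\mathcal S'(\mathbb R^n)$. Write $(\varphi,\psi)=\int \overline{\varphi}\,\psi\,d\xi$. Let $\mathcal L_k\subset\mathbb R^{2n}$ be an isotropic plane (a $k$-dimensional linear subspace on which $\omega$ vanishes) with a (nonzero, locally finite) translation-invariant measure $d\mu$. Let $\mathcal G_k$ be a gauge surface for $\mathcal L_k$ (a $k$-dimensional isotropic plane such that $\omega$ is nondegenerate on $\mathcal L_k+\mathcal G_k$) with a (nonzero, locally finite) translation-invariant measure $d\sigma$. For $\varphi,\psi\in\mathcal S(\mathbb R^n)$ put $\langle\varphi,\psi\rangle=\int_{\mathcal L_k}d\mu(X)\,(\varphi,e^{i\Omega(X)}\psi)$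 and $\eta\psi=\int_{\mathcal L_k}d\mu(X)\,e^{i\Omega(X)}\psi\in\mathcal S'(\mathbb R^n)$, and let $\mathcal H$ be the completion of $\mathcal S(\mathbb R^n)/\{\psi:\langle\psi,\psi\rangle=0\}$. The Dirac space $\mathcal H_D\subset\mathcal S'(\mathbb R^n)$ is the image of $\mathcal H$ under the continuous extension $\overline\eta$ of $\eta$: it consists of all $\psi_D=\lim_m\eta\psi_m$ (limit in $\mathcal S'(\mathbb R^n)$), where $(\psi_m)\subset\mathcal S(\mathbb R^n)$ is a Cauchy sequence for $\langle\cdot,\cdot\rangle$. The Dirac inner product is $\langle\overline\eta\,\overline\psi,\overline\eta\,\overline\psi\rangle_D=\langle\overline\psi,\overline\psi\rangle$, that is, $\langle\psi_D,\psi_D\rangle_D=\lim_m\langle\psi_m,\psi_m\rangle$ for every such sequence $(\psi_m)$. For $\psi_D\in\mathcal S'(\mathbb R^n)$ the distribution $R(Y)=(\psi_D,e^{i\Omega(Y)}\psi_D)$ on $\mathbb R^{2n}$ is given by $\int dY\,F(Y)R(Y)=\bigl(\psi_D,\int dY\,F(Y)e^{i\Omega(Y)}\psi_D\bigr)$ for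 $F\in\mathcal S(\mathbb R^{2n})$, where $\int dY\,F(Y)e^{i\Omega(Y)}\psi_D$ belongs to $\mathcal S(\mathbb R^n)$. A distribution $R$ on $\mathbb R^{2n}$ possesses a restriction to $\mathcal G_k$ if, for every linear complement $\mathcal N$ of $\mathcal G_k$, with the Lebesgue measure $d\nu$ on $\mathcal N$ such that $dY=d\sigma(x)\,d\nu(y)$ for $Y=x+y$, and for every $f\in\mathcal S(\mathcal G_k)$, the distribution $R_f(y)=\int d\sigma(x)f(x)R(x+y)$ on $\mathcal N$ is a continuous function of $y$ in a vicinity of $y=0$, the value $\int_{\mathcal G_k}d\sigma(x)f(x)R(x):=R_f(0)$ being the same for all $\mathcal N$. There is a constant $\Delta>0$, depending only on $\mathcal L_k,\mathcal G_k,d\mu,d\sigma$, such that the following holds. 1. For every $\rho\in\mathcal S(\mathcal G_k)$ the iterated integral converges absolutely (the inner integral for each $X$, and then the outer one) and $$\int_{\mathcal L_k} d\mu(X)\int_{\mathcal G_k} d\sigma(Y)\,\rho(Y)\,e^{i\omega(X,Y)}=\rho(0)\cdot\Delta .$$ 2. For every $\psi_D\in\mathcal H_D$, $(\psi_D,e^{i\Omega(Y)}\psi_D)$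 is a tempered distribution on $\mathbb R^{2n}$ that possesses a restriction to $\mathcal G_k$, which is a tempered distribution on $\mathcal G_k$, and for every $\rho\in\mathcal S(\mathcal G_k)$ with $\rho(0)=1/\Delta$, $$\langle\psi_D,\psi_D\rangle_D=\int_{\mathcal G_k}d\sigma(Y)\,\rho(Y)\,(\psi_D,e^{i\Omega(Y)}\psi_D).$$ -/

import Mathlib

open MeasureTheory Filter Topology
open scoped SchwartzMap

noncomputable section

/-- The configuration space `ℝⁿ` with its Euclidean structure. -/
abbrev Conf (n : ℕ) : Type := EuclideanSpace ℝ (Fin n)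

/-- The phase space `ℝ²ⁿ` of pairs `(P, Q)` (momenta, coordinates). -/
abbrev Phase (n : ℕ) : Type := Conf n × Conf n

/-- The symplectic form `ω((P,Q),(P',Q')) = ∑ⱼ (Pⱼ Q'ⱼ - P'ⱼ Qⱼ)`. -/
def symp {n : ℕ} (X Y : Phase n) : ℝ :=
  ∑ j, (X.1 j * Y.2 j - Y.1 j * X.2 j)

/-- A `k`-dimensional isotropic plane (linear subspace) in the phase space. -/
def IsIsotropicPlane {n : ℕ} (k : ℕ) (L : Submodule ℝ (Phase n)) : Prop :=
  Module.finrank ℝ L = k ∧ ∀ X ∈ L, ∀ Y ∈ L, symp X Y = 0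

/-- `G` is a gauge surface for the `k`-dimensional plane `L`: it is a `k`-dimensional isotropic
plane and `ω` is nondegenerate on `L + G`. -/
def IsGaugeSurface {n : ℕ} (k : ℕ) (L G : Submodule ℝ (Phase n)) : Prop :=
  IsIsotropicPlane k G ∧ ∀ Z ∈ L ⊔ G, (∀ W ∈ L ⊔ G, symp Z W = 0) → Z = 0

/-! ### The operators `Ω(X)` and `exp (i Ω(X))` -/

/-- `P · ξ = ∑ⱼ Pⱼ ξⱼ`. -/
def dotp {n : ℕ} (P ξ : Conf n) : ℝ := ∑ j, P j * ξ j

/-- The operator `Ω(P,Q) = ∑ⱼ (Pⱼ ξⱼ - Qⱼ (1/i) ∂/∂ξⱼ)`, acting on functions of `ξ`. -/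
def omegaOp {n : ℕ} (X : Phase n) (ψ : Conf n → ℂ) (ξ : Conf n) : ℂ :=
  (dotp X.1 ξ : ℂ) * ψ ξ - (1 / Complex.I) * fderiv ℝ ψ ξ X.2

/-- The phase factor `exp (i (P · ξ - P · Q / 2))`. -/
def weylPhase {n : ℕ} (X : Phase n) (ξ : Conf n) : ℂ :=
  Complex.exp (Complex.I * ((dotp X.1 ξ - dotp X.1 X.2 / 2 : ℝ) : ℂ))

/-- The unitary operator `exp (i Ω(P,Q))` on the Schwartz space:
`(exp (i Ω(P,Q)) ψ)(ξ) = exp (i (P · ξ - P · Q / 2)) ψ(ξ - Q)`.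
See `weyl_apply` and `weyl_hasDerivAt` below. -/
def weyl {n : ℕ} (X : Phase n) : 𝓢(Conf n, ℂ) →L[ℂ] 𝓢(Conf n, ℂ) :=
  (SchwartzMap.smulLeftCLM ℂ (weylPhase X)).comp (SchwartzMap.compSubConstCLM ℂ X.2)

theorem dotp_eq_inner {n : ℕ} (P ξ : Conf n) : dotp P ξ = inner ℝ P ξ := by
  simp only [dotp, PiLp.inner_apply, RCLike.inner_apply, conj_trivial]
  exact Finset.sum_congr rfl fun j _ => mul_comm _ _

theorem expI_hasTemperateGrowth :
    (fun t : ℝ => Complex.exp (Complex.I * (t : ℂ))).HasTemperateGrowth := by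
  have hd : ∀ t : ℝ, HasDerivAt (fun t : ℝ => Complex.exp (Complex.I * (t : ℂ)))
      (Complex.I * Complex.exp (Complex.I * (t : ℂ))) t := by
    intro t
    have h := (((Complex.ofRealCLM.hasDerivAt (x := t)).const_mul Complex.I).cexp)
    simpa [mul_comm] using h
  have hit : ∀ m : ℕ, iteratedDeriv m (fun t : ℝ => Complex.exp (Complex.I * (t : ℂ)))
      = fun t : ℝ => Complex.I ^ m * Complex.exp (Complex.I * (t : ℂ)) := by
    intro m
    induction m with
    | zero => simp
    | succ m ih =>
      rw [iteratedDeriv_succ, ih]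
      funext t
      rw [((hd t).const_mul (Complex.I ^ m)).deriv, pow_succ]
      ring
  refine ⟨(contDiff_const.mul Complex.ofRealCLM.contDiff).cexp, fun m => ⟨0, 1, fun t => ?_⟩⟩
  rw [norm_iteratedFDeriv_eq_norm_iteratedDeriv, hit m]
  simp [Complex.norm_exp]

theorem weylPhase_hasTemperateGrowth {n : ℕ} (X : Phase n) :
    (weylPhase X).HasTemperateGrowth := by
  have h : (fun ξ : Conf n => dotp X.1 ξ - dotp X.1 X.2 / 2).HasTemperateGrowth := by
    simp only [dotp_eq_inner]
    fun_prop
  exact expI_hasTemperateGrowth.comp h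

theorem weyl_apply {n : ℕ} (X : Phase n) (ψ : 𝓢(Conf n, ℂ)) (ξ : Conf n) :
    weyl X ψ ξ = weylPhase X ξ * ψ (ξ - X.2) := by
  simp [weyl, SchwartzMap.smulLeftCLM_apply_apply (weylPhase_hasTemperateGrowth X)]

theorem weyl_zero {n : ℕ} (ψ : 𝓢(Conf n, ℂ)) : weyl 0 ψ = ψ := by
  ext ξ
  simp [weyl_apply, weylPhase, dotp]

/-- `t ↦ exp (i Ω(t X)) ψ` solves `dψₜ/dt = i Ω(X) ψₜ`, so that `weyl X` is `exp (i Ω(X))`. -/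
theorem weyl_hasDerivAt {n : ℕ} (X : Phase n) (ψ : 𝓢(Conf n, ℂ)) (ξ : Conf n) (t : ℝ) :
    HasDerivAt (fun s : ℝ => weyl (s • X) ψ ξ)
      (Complex.I * omegaOp X (weyl (t • X) ψ) ξ) t := by
  have hW : ∀ (s : ℝ) (η : Conf n), weyl (s • X) ψ η
      = Complex.exp (Complex.I * ((s * dotp X.1 η - s ^ 2 * dotp X.1 X.2 / 2 : ℝ) : ℂ))
        * ψ (η - s • X.2) := by
    intro s η
    rw [weyl_apply, weylPhase]
    simp only [dotp_eq_inner, Prod.smul_fst, Prod.smul_snd, real_inner_smul_left,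
      real_inner_smul_right]
    congr 4
    ring
  have hψ : ∀ η, HasFDerivAt (ψ : Conf n → ℂ) (fderiv ℝ ψ η) η := fun η =>
    ψ.differentiableAt.hasFDerivAt
  have h1 : HasDerivAt (fun s : ℝ => weyl (s • X) ψ ξ)
      (Complex.exp (Complex.I * ((t * dotp X.1 ξ - t ^ 2 * dotp X.1 X.2 / 2 : ℝ) : ℂ))
        * (Complex.I * ((dotp X.1 ξ - t * dotp X.1 X.2 : ℝ) : ℂ)) * ψ (ξ - t • X.2)
      + Complex.exp (Complex.I * ((t * dotp X.1 ξ - t ^ 2 * dotp X.1 X.2 / 2 : ℝ) : ℂ))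
        * fderiv ℝ ψ (ξ - t • X.2) (-X.2)) t := by
    simp only [hW]
    refine HasDerivAt.mul (HasDerivAt.cexp (HasDerivAt.const_mul _ (HasDerivAt.ofReal_comp ?_))) ?_
    · have h := ((hasDerivAt_id t).mul_const (dotp X.1 ξ)).sub
        ((((hasDerivAt_id t).pow 2).mul_const (dotp X.1 X.2)).div_const 2)
      refine h.congr_deriv ?_
      simp
      ring
    · refine (hψ _).comp_hasDerivAt t ?_
      have h := ((hasDerivAt_id t).smul_const X.2).const_sub ξ
      simpa using h
  have h2 : HasDerivAt (fun s : ℝ => weyl (t • X) ψ (ξ + s • X.2))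
      (Complex.exp (Complex.I * ((t * dotp X.1 ξ - t ^ 2 * dotp X.1 X.2 / 2 : ℝ) : ℂ))
        * (Complex.I * ((t * dotp X.1 X.2 : ℝ) : ℂ)) * ψ (ξ - t • X.2)
      + Complex.exp (Complex.I * ((t * dotp X.1 ξ - t ^ 2 * dotp X.1 X.2 / 2 : ℝ) : ℂ))
        * fderiv ℝ ψ (ξ - t • X.2) X.2) 0 := by
    have e : ∀ s : ℝ, dotp X.1 (ξ + s • X.2) = dotp X.1 ξ + s * dotp X.1 X.2 := by
      intro s
      simp only [dotp_eq_inner, inner_add_right, real_inner_smul_right]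
    simp only [hW, e]
    have ha : HasDerivAt (fun s : ℝ => t * (dotp X.1 ξ + s * dotp X.1 X.2)
        - t ^ 2 * dotp X.1 X.2 / 2) (t * dotp X.1 X.2) 0 := by
      have h := ((((hasDerivAt_id (0 : ℝ)).mul_const (dotp X.1 X.2)).const_add
        (dotp X.1 ξ)).const_mul t).sub_const (t ^ 2 * dotp X.1 X.2 / 2)
      simpa using h
    have hb : HasDerivAt (fun s : ℝ => ξ + s • X.2 - t • X.2) X.2 0 := by
      have h := (((hasDerivAt_id (0 : ℝ)).smul_const X.2).const_add ξ).sub_const (t • X.2)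
      simpa using h
    have hc := HasFDerivAt.comp_hasDerivAt (0 : ℝ) (hψ _) hb
    have h := ((ha.ofReal_comp.const_mul Complex.I).cexp).mul hc
    refine HasDerivAt.congr_deriv h ?_
    simp
  have h3 : fderiv ℝ (weyl (t • X) ψ) ξ X.2 =
      Complex.exp (Complex.I * ((t * dotp X.1 ξ - t ^ 2 * dotp X.1 X.2 / 2 : ℝ) : ℂ))
        * (Complex.I * ((t * dotp X.1 X.2 : ℝ) : ℂ)) * ψ (ξ - t • X.2)
      + Complex.exp (Complex.I * ((t * dotp X.1 ξ - t ^ 2 * dotp X.1 X.2 / 2 : ℝ) : ℂ))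
        * fderiv ℝ ψ (ξ - t • X.2) X.2 := by
    have hd : HasFDerivAt (weyl (t • X) ψ : Conf n → ℂ) (fderiv ℝ (weyl (t • X) ψ) ξ)
        (ξ + (0 : ℝ) • X.2) := by
      simpa using (weyl (t • X) ψ).differentiableAt.hasFDerivAt
    have hb : HasDerivAt (fun s : ℝ => ξ + s • X.2) X.2 0 := by
      have h := ((hasDerivAt_id (0 : ℝ)).smul_const X.2).const_add ξ
      simpa using h
    exact (hd.comp_hasDerivAt (0 : ℝ) hb).unique h2
  refine h1.congr_deriv ?_
  rw [omegaOp, h3, hW]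
  simp only [map_neg, one_div, Complex.inv_I]
  push_cast
  linear_combination (Complex.exp (Complex.I * (t * dotp X.1 ξ - t ^ 2 * dotp X.1 X.2 / 2))
    * (- Complex.I * (t * dotp X.1 X.2) * ψ (ξ - t • X.2)
       - fderiv ℝ ψ (ξ - t • X.2) X.2)) * Complex.I_sq

/-- The Weyl relation `exp (iΩ(X)) exp (iΩ(X')) = exp (iΩ(X + X')) exp ((i/2) ω(X,X'))`. -/
theorem weyl_weyl {n : ℕ} (X Y : Phase n) (ψ : 𝓢(Conf n, ℂ)) :
    weyl X (weyl Y ψ) = Complex.exp (Complex.I / 2 * (symp X Y : ℂ)) • weyl (X + Y) ψ := by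
  ext ξ
  have hs : symp X Y = dotp X.1 Y.2 - dotp Y.1 X.2 := by
    simp [symp, dotp, Finset.sum_sub_distrib]
  have hξ : ξ - X.2 - Y.2 = ξ - (X + Y).2 := by
    rw [Prod.snd_add, sub_sub]
  rw [smul_apply, weyl_apply, weyl_apply, weyl_apply, hξ, smul_eq_mul, ← mul_assoc,
    ← mul_assoc]
  congr 1
  simp only [weylPhase]
  rw [← Complex.exp_add, ← Complex.exp_add, hs]
  congr 1
  simp only [dotp_eq_inner, Prod.fst_add, Prod.snd_add, inner_add_left, inner_add_right,
    inner_sub_right]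
  push_cast
  ring

/-- The transpose of `exp (i Ω(P,Q))` for the bilinear pairing `∫ ψ χ dξ` is
`exp (i Ω(P,-Q))`. -/
theorem integral_weyl_mul {n : ℕ} (X : Phase n) (ψ χ : 𝓢(Conf n, ℂ)) :
    ∫ ξ, weyl X ψ ξ * χ ξ = ∫ ξ, ψ ξ * weyl (X.1, -X.2) χ ξ := by
  rw [← integral_add_right_eq_self (fun ξ => weyl X ψ ξ * χ ξ) X.2]
  congr 1
  funext ξ
  have h : weylPhase X (ξ + X.2) = weylPhase (X.1, -X.2) ξ := by
    simp only [weylPhase, dotp_eq_inner, inner_add_right, inner_neg_right]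
    congr 3
    ring
  simp only [weyl_apply, h, sub_neg_eq_add, add_sub_cancel_right]
  ring

/-- `exp (i Ω(Y))` on tempered distributions, the transpose of `exp (i Ω(P,-Q))`; by
`integral_weyl_mul` it extends `exp (i Ω(Y))` on Schwartz functions. -/
def weylDistr {n : ℕ} (Y : Phase n) (ψ : 𝓢'(Conf n, ℂ)) (χ : 𝓢(Conf n, ℂ)) : ℂ :=
  ψ (weyl (Y.1, -Y.2) χ)

/-- Complex conjugation of Schwartz functions. -/
def conjS {n : ℕ} (ψ : 𝓢(Conf n, ℂ)) : 𝓢(Conf n, ℂ) :=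
  SchwartzMap.postcompCLM (𝕜 := ℝ) (Complex.conjCLE : ℂ →L[ℝ] ℂ) ψ

theorem conjS_apply {n : ℕ} (ψ : 𝓢(Conf n, ℂ)) (ξ : Conf n) :
    conjS ψ ξ = (starRingEnd ℂ) (ψ ξ) := rfl

/-! ### The algebraic inner product and the Dirac space -/

/-- The inner product `(φ, ψ) = ∫ φ* ψ dξ`. -/
def innerS {n : ℕ} (φ ψ : 𝓢(Conf n, ℂ)) : ℂ :=
  ∫ ξ, (starRingEnd ℂ) (φ ξ) * ψ ξ

/-- The algebraic inner product `⟨φ, ψ⟩ = ∫_L dμ(X) (φ, exp (i Ω(X)) ψ)`. -/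
def algInner {n : ℕ} {L : Submodule ℝ (Phase n)} (μ : Measure L) (φ ψ : 𝓢(Conf n, ℂ)) : ℂ :=
  ∫ X : L, innerS φ (weyl (X : Phase n) ψ) ∂μ

/-- The distribution `η ψ = ∫_L dμ(X) exp (i Ω(X)) ψ`, evaluated at the test function `χ`. -/
def etaMap {n : ℕ} {L : Submodule ℝ (Phase n)} (μ : Measure L) (ψ χ : 𝓢(Conf n, ℂ)) : ℂ :=
  ∫ X : L, (∫ ξ, weyl (X : Phase n) ψ ξ * χ ξ) ∂μ

/-- The sequence `u` is fundamental for the seminorm of the algebraic inner product, so that it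
represents a vector of the completion of the quotient of the Schwartz space by the null vectors. -/
def IsFundamental {n : ℕ} {L : Submodule ℝ (Phase n)} (μ : Measure L)
    (u : ℕ → 𝓢(Conf n, ℂ)) : Prop :=
  ∀ ε : ℝ, 0 < ε → ∃ M : ℕ, ∀ m ≥ M, ∀ l ≥ M, ‖algInner μ (u m - u l) (u m - u l)‖ < ε

/-- `ψD` is the image, under the continuous extension of `η` to the completion, of the vector that
the fundamental sequence `u` represents: `η (u m) → ψD` in the space of tempered distributions. -/
def Represents {n : ℕ} {L : Submodule ℝ (Phase n)} (μ : Measure L)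
    (u : ℕ → 𝓢(Conf n, ℂ)) (ψD : 𝓢'(Conf n, ℂ)) : Prop :=
  IsFundamental μ u ∧ ∀ χ : 𝓢(Conf n, ℂ), Tendsto (fun m => etaMap μ (u m) χ) atTop (𝓝 (ψD χ))

/-- The physical space of the Dirac approach: the image of the completion under the extension
of `η`. -/
def diracSpace {n : ℕ} {L : Submodule ℝ (Phase n)} (μ : Measure L) : Set (𝓢'(Conf n, ℂ)) :=
  {ψD | ∃ u, Represents μ u ψD}

/-- `z` is the Dirac inner product `⟨ψD, ψD⟩_D`, i.e. the inner square in the completion of the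
vector that `ψD` comes from: the limit of `⟨u m, u m⟩` for every sequence `u` representing `ψD`. -/
def IsDiracInnerSelf {n : ℕ} {L : Submodule ℝ (Phase n)} (μ : Measure L)
    (ψD : 𝓢'(Conf n, ℂ)) (z : ℂ) : Prop :=
  ψD ∈ diracSpace μ ∧
    ∀ u, Represents μ u ψD → Tendsto (fun m => algInner μ (u m) (u m)) atTop (𝓝 z)

/-! ### The distribution `(ψ, exp (i Ω(Y)) ψ)` and its restriction to a plane -/

/-- The Schwartz function `g` is the distribution `∫ dY F(Y) exp (i Ω(Y)) ψ`, the integral being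
absolutely convergent against every test function. -/
def IsSmeared {n : ℕ} (ψ : 𝓢'(Conf n, ℂ)) (F : 𝓢(Phase n, ℂ)) (g : 𝓢(Conf n, ℂ)) : Prop :=
  ∀ χ : 𝓢(Conf n, ℂ), Integrable (fun Y : Phase n => F Y * weylDistr Y ψ χ) ∧
    ∫ ξ, g ξ * χ ξ = ∫ Y : Phase n, F Y * weylDistr Y ψ χ

/-- The tempered distribution `R` on the phase space is `R(Y) = (φ, exp (i Ω(Y)) ψ)` for the
tempered distributions `φ`, `ψ`: for each test function `F`, the distribution
`∫ dY F(Y) exp (i Ω(Y)) ψ` is a Schwartz function `g`, and `∫ dY F(Y) R(Y) = (φ, g)`, where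
`(φ, g) = (∫ φ g*)*`. -/
def IsMatrixElement {n : ℕ} (φ ψ : 𝓢'(Conf n, ℂ)) (R : 𝓢'(Phase n, ℂ)) : Prop :=
  ∀ F : 𝓢(Phase n, ℂ), ∃ g : 𝓢(Conf n, ℂ), IsSmeared ψ F g ∧
    R F = (starRingEnd ℂ) (φ (conjS g))

/-- The distribution `R` on the phase space possesses a restriction to the plane `G` with measure
`σ`, and `S` is this restriction. That is, for each complement `N` of `G`, with the Lebesgue
measure `ν` such that `dY = dσ(x) dν(y)` for `Y = x + y`, `x ∈ G`, `y ∈ N`, and for each test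
function `f` on `G`, the distribution `∫ dσ(x) f(x) R(x + y)` in `y` is, in a vicinity `U` of
`y = 0`, a continuous function `h(y)`, and the value `∫ dσ(x) f(x) R(x)` of the restriction
at `f` is `h(0)`. -/
def IsRestriction {n : ℕ} (R : 𝓢'(Phase n, ℂ)) (G : Submodule ℝ (Phase n)) (σ : Measure G)
    (S : 𝓢'(G, ℂ)) : Prop :=
  ∀ (N : Submodule ℝ (Phase n)) (ν : Measure N), IsCompl G N → ν.IsAddHaarMeasure →
    Measure.map (fun p : G × N => (p.1 : Phase n) + (p.2 : Phase n)) (σ.prod ν) = volume →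
    ∀ f : 𝓢(G, ℂ), ∃ U ∈ 𝓝 (0 : N), ∃ h : N → ℂ, ContinuousOn h U ∧ h 0 = S f ∧
      ∀ χ : 𝓢(N, ℂ), HasCompactSupport χ → tsupport χ ⊆ U →
        ∀ F : 𝓢(Phase n, ℂ), (∀ (x : G) (y : N), F ((x : Phase n) + (y : Phase n)) = f x * χ y) →
          R F = ∫ y, χ y * h y ∂ν

end

noncomputable section

set_option linter.unusedSectionVars false

/-! ### Constructing Schwartz functions -/

section SchwartzCriterion

variable {E : Type*} [NormedAddCommGroup E] [NormedSpace ℝ E] [FiniteDimensional ℝ E]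

/-! Let `Ψ` be the vector of the completion `H` behind `ψ_D`, and `L^⊥` the symplectic orthogonal
complement of `L`. Averaging over `L` makes `exp (iΩ(X))`, `X ∈ L`, act trivially on `H`
(`toH_weyl`). For `Z ∈ L^⊥` the Weyl operator commutes with the average and is isometric on `H`
(`norm_toH_weyl`). Hence moving `exp (iΩ(X))` past `exp (iΩ(Y))` in a matrix element leaves only the
phase `exp (i ω(X,Y))` (`vectorMatrixElement_weyl`).

The form `ω` puts `L` and `G` in duality, so the first formula is Fourier inversion at the origin,
with `Δ` the product of two Jacobians (`exists_fourier_inversion_zero`). Moreover `G` is a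
complement of `L^⊥` (`IsGaugeSurface.isCompl_sympOrth`), so integrating these phases over `L`
produces `Δ` times the delta measure on `L^⊥` (`integral_integral_phase`). Consequently `(ψ_D, exp
(iΩ(Y)) ψ_D)` is carried by `L^⊥`, where it has the bounded continuous density `Δ ⟨Ψ, exp (iΩ(z))
Ψ⟩` (`exists_matrixElement_density`). Transversality of `G` and `L^⊥` makes the restriction to `G`
equal to `Δ ⟨Ψ, Ψ⟩` times the delta distribution at 0 (`isRestriction_of_density`); testing with
`ρ(0) = 1/Δ` leaves `⟨Ψ, Ψ⟩`.

Two points support this. Positivity of the averaged form (`re_algInner_self_nonneg`) is needed for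
`H` to exist, and a vector of `H` is determined by its distribution (`eq_of_diracPairing`), so the
Dirac inner square does not depend on the sequence. The analytic tool is families of Schwartz
functions depending on parameters in a Schwartz way: their matrix elements and pairings with `H` are
again Schwartz, which justifies the exchanges of integrals. -/

theorem norm_pow_mul_bounded_of_class {𝒞 : Set (E → ℂ)}
    (hb : ∀ g ∈ 𝒞, ∃ C, ∀ x, ‖g x‖ ≤ C)
    (hm : ∀ g ∈ 𝒞, ∀ ℓ : E →L[ℝ] ℝ, (fun x => (ℓ x : ℂ) * g x) ∈ 𝒞) (k : ℕ) :
    ∀ g ∈ 𝒞, ∃ C, ∀ x, ‖x‖ ^ k * ‖g x‖ ≤ C := by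
  induction k with
  | zero => simpa using hb
  | succ k ih =>
    intro g hg
    let b := Module.finBasis ℝ E
    -- One factor `‖x‖` is traded for coordinate functionals, which the class absorbs.
    have hx : ∀ x : E, ‖x‖ ≤ ∑ i, ‖b i‖ * ‖b.coord i x‖ := by
      intro x
      conv_lhs => rw [← b.sum_repr x]
      refine (norm_sum_le _ _).trans (Finset.sum_le_sum fun i _ => ?_)
      rw [norm_smul, mul_comm]
      rfl
    choose C hC using fun i => ih _ (hm g hg (LinearMap.toContinuousLinearMap (b.coord i)))
    refine ⟨∑ i, ‖b i‖ * C i, fun x => ?_⟩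
    calc ‖x‖ ^ (k + 1) * ‖g x‖ = ‖x‖ * (‖x‖ ^ k * ‖g x‖) := by ring
      _ ≤ (∑ i, ‖b i‖ * ‖b.coord i x‖) * (‖x‖ ^ k * ‖g x‖) := by gcongr; exact hx x
      _ = ∑ i, ‖b i‖ * (‖x‖ ^ k * (‖b.coord i x‖ * ‖g x‖)) := by
        rw [Finset.sum_mul]
        exact Finset.sum_congr rfl fun i _ => by ring
      _ ≤ ∑ i, ‖b i‖ * C i := by
        refine Finset.sum_le_sum fun i _ => mul_le_mul_of_nonneg_left ?_ (norm_nonneg _)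
        have := hC i x
        rwa [norm_mul, Complex.norm_real] at this

theorem contDiff_of_class {𝒞 : Set (E → ℂ)}
    (hd : ∀ g ∈ 𝒞, Differentiable ℝ g ∧ ∀ v, (fun x => fderiv ℝ g x v) ∈ 𝒞) (n : ℕ) :
    ∀ g ∈ 𝒞, ContDiff ℝ n g := by
  induction n with
  | zero => exact fun g hg => contDiff_zero.2 (hd g hg).1.continuous
  | succ n ih =>
    intro g hg
    have := (contDiff_succ_iff_fderiv_apply (𝕜 := ℝ) (n := n) (f := g)).2
      ⟨(hd g hg).1, by simp, fun v => ih _ ((hd g hg).2 v)⟩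
    exact_mod_cast this

/-- A class of bounded functions on a finite-dimensional space that is closed under directional
derivatives and under multiplication by linear functionals consists of Schwartz functions. -/
theorem exists_schwartz_of_class {𝒞 : Set (E → ℂ)}
    (hb : ∀ g ∈ 𝒞, ∃ C, ∀ x, ‖g x‖ ≤ C)
    (hm : ∀ g ∈ 𝒞, ∀ ℓ : E →L[ℝ] ℝ, (fun x => (ℓ x : ℂ) * g x) ∈ 𝒞)
    (hd : ∀ g ∈ 𝒞, Differentiable ℝ g ∧ ∀ v, (fun x => fderiv ℝ g x v) ∈ 𝒞)
    {g : E → ℂ} (hg : g ∈ 𝒞) : ∃ f : 𝓢(E, ℂ), ∀ x, f x = g x := by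
  have hs : ∀ g ∈ 𝒞, ∀ n : ℕ, ContDiff ℝ n g := fun g hg n => contDiff_of_class hd n g hg
  have key : ∀ (n : ℕ) (k : ℕ), ∀ g ∈ 𝒞, ∃ C, ∀ x, ‖x‖ ^ k * ‖iteratedFDeriv ℝ n g x‖ ≤ C := by
    intro n k
    induction n with
    | zero => simpa using norm_pow_mul_bounded_of_class hb hm k
    | succ n ih =>
      intro g hg
      let b := Module.finBasis ℝ E
      let c : Fin (Module.finrank ℝ E) → E →L[ℝ] ℝ := fun i =>
        LinearMap.toContinuousLinearMap (b.coord i)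
      let Λ : Fin (Module.finrank ℝ E) → ℂ →L[ℝ] (E →L[ℝ] ℂ) := fun i =>
        ContinuousLinearMap.smulRightL ℝ E ℂ (c i)
      -- The full derivative is a sum of fixed linear maps `Λ i` applied to directional derivatives,
      -- to which the induction hypothesis applies.
      have hf : fderiv ℝ g = fun x => ∑ i, (Λ i ∘ fun x => fderiv ℝ g x (b i)) x := by
        funext x
        ext v
        have h : fderiv ℝ g x v = fderiv ℝ g x (∑ i, b.repr v i • b i) := by rw [b.sum_repr v]
        rw [h, map_sum]
        simp [Λ, c]
      choose C hC using fun i => ih _ ((hd g hg).2 (b i))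
      refine ⟨∑ i, ‖Λ i‖ * C i, fun x => ?_⟩
      rw [← norm_iteratedFDeriv_fderiv, hf]
      have hcd : ∀ i, ContDiff ℝ n (fun x => fderiv ℝ g x (b i)) := fun i =>
        hs _ ((hd g hg).2 (b i)) n
      rw [iteratedFDeriv_sum (fun i _ => (Λ i).contDiff.comp (hcd i))]
      rw [Finset.sum_apply]
      calc _ ≤ ‖x‖ ^ k * ∑ i, ‖Λ i‖ * ‖iteratedFDeriv ℝ n (fun x => fderiv ℝ g x (b i)) x‖ := by
            gcongr
            refine (norm_sum_le _ _).trans (Finset.sum_le_sum fun i _ => ?_)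
            exact (Λ i).norm_iteratedFDeriv_comp_left (hcd i).contDiffAt le_rfl
        _ = ∑ i, ‖Λ i‖ * (‖x‖ ^ k * ‖iteratedFDeriv ℝ n (fun x => fderiv ℝ g x (b i)) x‖) := by
            rw [Finset.mul_sum]
            exact Finset.sum_congr rfl fun i _ => by ring
        _ ≤ _ := Finset.sum_le_sum fun i _ => mul_le_mul_of_nonneg_left (hC i x) (norm_nonneg (Λ i))
  exact ⟨⟨g, contDiff_infty.2 (hs g hg), fun k n => key n k g hg⟩, fun x => rfl⟩

end SchwartzCriterion

/-! ### Tensor products and injective linear pullbacks of Schwartz functions -/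

namespace SchwartzMap

section Tensor

variable {E F : Type*} [NormedAddCommGroup E] [NormedSpace ℝ E] [NormedAddCommGroup F]
  [NormedSpace ℝ F]

theorem norm_iteratedFDeriv_comp_clm_le {D : Type*} [NormedAddCommGroup D] [NormedSpace ℝ D]
    (f : 𝓢(E, ℂ)) (g : D →L[ℝ] E) (hg : ‖g‖ ≤ 1) (n : ℕ) (x : D) :
    ‖iteratedFDeriv ℝ n (fun x => f (g x)) x‖ ≤ ‖iteratedFDeriv ℝ n f (g x)‖ := by
  have h := g.iteratedFDeriv_comp_right (f.smooth n) x (i := n) le_rfl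
  change ‖iteratedFDeriv ℝ n (f ∘ g) x‖ ≤ _
  rw [h]
  refine (ContinuousMultilinearMap.norm_compContinuousLinearMap_le _ _).trans ?_
  simp only [Finset.prod_const, Finset.card_univ, Fintype.card_fin]
  exact mul_le_of_le_one_right (norm_nonneg _) (pow_le_one₀ (norm_nonneg _) hg)

/-- The tensor product `(x, y) ↦ f x * g y` of two Schwartz functions. -/
def tensor (f : 𝓢(E, ℂ)) (g : 𝓢(F, ℂ)) : 𝓢(E × F, ℂ) where
  toFun z := f z.1 * g z.2
  smooth' := ((f.smooth ⊤).comp contDiff_fst).mul ((g.smooth ⊤).comp contDiff_snd)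
  decay' k n := by
    choose Cf hCf hf using fun k n => f.decay k n
    choose Cg hCg hg using fun k n => g.decay k n
    refine ⟨∑ i ∈ Finset.range (n + 1), (n.choose i : ℝ) *
      (Cf k i * Cg 0 (n - i) + Cf 0 i * Cg k (n - i)), fun z => ?_⟩
    have h1 := norm_iteratedFDeriv_mul_le (𝕜 := ℝ) (N := n)
      ((f.smooth n).comp (contDiff_fst (𝕜 := ℝ) (E := E) (F := F)))
      ((g.smooth n).comp (contDiff_snd (𝕜 := ℝ) (E := E) (F := F))) z (n := n) le_rfl
    refine (mul_le_mul_of_nonneg_left h1 (by positivity)).trans ?_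
    rw [Finset.mul_sum]
    refine Finset.sum_le_sum fun i _ => ?_
    have hf' : ‖iteratedFDeriv ℝ i (f ∘ Prod.fst) z‖ ≤ ‖iteratedFDeriv ℝ i f z.1‖ :=
      norm_iteratedFDeriv_comp_clm_le f (.fst ℝ E F) (ContinuousLinearMap.norm_fst_le ..) i z
    have hg' : ‖iteratedFDeriv ℝ (n - i) (g ∘ Prod.snd) z‖ ≤ ‖iteratedFDeriv ℝ (n - i) g z.2‖ :=
      norm_iteratedFDeriv_comp_clm_le g (.snd ℝ E F) (ContinuousLinearMap.norm_snd_le ..) _ z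
    have hz : ‖z‖ ^ k ≤ ‖z.1‖ ^ k + ‖z.2‖ ^ k := by
      rcases max_choice ‖z.1‖ ‖z.2‖ with h | h <;> rw [Prod.norm_def, h]
      · exact le_add_of_nonneg_right (by positivity)
      · exact le_add_of_nonneg_left (by positivity)
    calc _ ≤ (‖z.1‖ ^ k + ‖z.2‖ ^ k) * ((n.choose i : ℝ) * ‖iteratedFDeriv ℝ i f z.1‖ *
            ‖iteratedFDeriv ℝ (n - i) g z.2‖) := by gcongr
      _ = (n.choose i : ℝ) * ((‖z.1‖ ^ k * ‖iteratedFDeriv ℝ i f z.1‖) *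
            (‖z.2‖ ^ 0 * ‖iteratedFDeriv ℝ (n - i) g z.2‖) +
            (‖z.1‖ ^ 0 * ‖iteratedFDeriv ℝ i f z.1‖) *
            (‖z.2‖ ^ k * ‖iteratedFDeriv ℝ (n - i) g z.2‖)) := by ring
      _ ≤ _ := by
        gcongr
        · exact (hCf k i).le
        · exact hf k i z.1
        · exact hg 0 (n - i) z.2
        · exact (hCf 0 i).le
        · exact hf 0 i z.1
        · exact hg k (n - i) z.2

@[simp]
theorem tensor_apply (f : 𝓢(E, ℂ)) (g : 𝓢(F, ℂ)) (z : E × F) : tensor f g z = f z.1 * g z.2 := rfl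

end Tensor

section Pullback

variable {D E F : Type*} [NormedAddCommGroup D] [NormedSpace ℝ D] [FiniteDimensional ℝ D]
  [NormedAddCommGroup E] [NormedSpace ℝ E] [NormedAddCommGroup F] [NormedSpace ℝ F]

/-- The pullback of a Schwartz function along an injective linear map. -/
theorem exists_comp_injective (f : 𝓢(E, F)) (A : D →ₗ[ℝ] E) (hA : Function.Injective A) :
    ∃ g : 𝓢(D, F), ∀ x, g x = f (A x) := by
  obtain ⟨K, -, hK⟩ := A.exists_antilipschitzWith (LinearMap.ker_eq_bot.2 hA)
  exact ⟨compCLMOfAntilipschitz ℝ (g := A) (LinearMap.toContinuousLinearMap A).hasTemperateGrowth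
    hK f, fun x => rfl⟩

end Pullback

/-! ### Partial Fourier integrals with parameters -/

section Partial

variable {M V F : Type*} [NormedAddCommGroup M] [NormedSpace ℝ M]
  [NormedAddCommGroup V] [NormedSpace ℝ V] [NormedAddCommGroup F] [NormedSpace ℝ F]
  [MeasurableSpace M]

/-- The slices of a Schwartz function on a product have a common integrable majorant. -/
theorem exists_integrable_majorant (μ : Measure M) [μ.HasTemperateGrowth]
    (f : 𝓢(M × V, F)) (k : ℕ) :
    ∃ b : M → ℝ, Integrable b μ ∧ ∀ y v, ‖y‖ ^ k * ‖f (y, v)‖ ≤ b y := by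
  let l := μ.integrablePower
  refine ⟨fun y => 2 ^ (k + l) * ((Finset.Iic (k + l, 0)).sup
    (fun m => SchwartzMap.seminorm ℝ m.1 m.2)) f * (1 + ‖y‖) ^ (-(l : ℝ)),
    (Measure.integrable_pow_neg_integrablePower μ).const_mul _, fun y v => ?_⟩
  -- The extra weight `l` pays for integrability in `y`; since `‖y‖ ≤ ‖(y, v)‖`, the bound is
  -- uniform in `v`.
  have h := one_add_le_sup_seminorm_apply (𝕜 := ℝ) (m := (k + l, 0)) (k := k + l) (n := 0)
    le_rfl le_rfl f (y, v)
  rw [norm_iteratedFDeriv_zero] at h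
  have hy : ‖y‖ ≤ ‖(y, v)‖ := le_max_left _ _
  have h1 : 0 < 1 + ‖y‖ := by positivity
  beta_reduce
  rw [Real.rpow_neg h1.le, Real.rpow_natCast, ← div_eq_mul_inv, le_div_iff₀ (by positivity)]
  refine le_trans ?_ h
  calc _ = ‖y‖ ^ k * (1 + ‖y‖) ^ l * ‖f (y, v)‖ := by ring
    _ ≤ (1 + ‖(y, v)‖) ^ k * (1 + ‖(y, v)‖) ^ l * ‖f (y, v)‖ := by
      gcongr
      exact hy.trans (le_add_of_nonneg_left zero_le_one)
    _ = _ := by rw [pow_add]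

variable [FiniteDimensional ℝ M] [FiniteDimensional ℝ V] [BorelSpace M]
  {P : Type*} [NormedAddCommGroup P] [NormedSpace ℝ P] [FiniteDimensional ℝ P]

theorem integrable_slice_left (μ : Measure M) [μ.IsAddHaarMeasure] (f : 𝓢(M × V, ℂ)) (v : V) :
    Integrable (fun y => f (y, v)) μ := by
  obtain ⟨b, hb, hfb⟩ := exists_integrable_majorant μ f 0
  refine hb.mono' (Continuous.aestronglyMeasurable ?_) (.of_forall fun y => ?_)
  · exact f.continuous.comp (by fun_prop)
  · simpa using hfb y v

theorem norm_cexp_I_mul_ofReal (t : ℝ) : ‖Complex.exp (Complex.I * t)‖ = 1 := by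
  rw [mul_comm, Complex.norm_exp_ofReal_mul_I]

theorem integrable_phase_mul_slice (μ : Measure M) [μ.IsAddHaarMeasure] (f : 𝓢(M × V, ℂ))
    (φ : M →L[ℝ] ℝ) (v : V) :
    Integrable (fun y => Complex.exp (Complex.I * (φ y : ℂ)) * f (y, v)) μ := by
  refine (integrable_slice_left μ f v).mono (Continuous.aestronglyMeasurable ?_)
    (.of_forall fun y => ?_)
  · have := f.continuous
    fun_prop
  · rw [norm_mul, norm_cexp_I_mul_ofReal, one_mul]

/-- The derivative of the integrand of a partial Fourier integral. -/
def partialFourierDeriv (B : P →L[ℝ] M →L[ℝ] ℝ) (f : 𝓢(M × V, ℂ)) (z : P × V) (y : M) :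
    P × V →L[ℝ] ℂ :=
  Complex.exp (Complex.I * (B z.1 y : ℂ)) • (fderiv ℝ f (y, z.2) ∘L
      (ContinuousLinearMap.inr ℝ M V) ∘L (ContinuousLinearMap.snd ℝ P V)) +
  f (y, z.2) • (Complex.exp (Complex.I * (B z.1 y : ℂ)) • Complex.I •
    (Complex.ofRealCLM ∘L (B.flip y) ∘L (ContinuousLinearMap.fst ℝ P V)))

theorem partialFourier_hasFDerivAt_integrand (B : P →L[ℝ] M →L[ℝ] ℝ) (f : 𝓢(M × V, ℂ))
    (z : P × V) (y : M) :
    HasFDerivAt (fun z : P × V => Complex.exp (Complex.I * (B z.1 y : ℂ)) * f (y, z.2))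
      (partialFourierDeriv B f z y) z := by
  have h1 : HasFDerivAt (fun z : P × V => (B z.1 y : ℂ))
      (Complex.ofRealCLM ∘L (B.flip y) ∘L (ContinuousLinearMap.fst ℝ P V)) z :=
    (Complex.ofRealCLM ∘L (B.flip y) ∘L (ContinuousLinearMap.fst ℝ P V)).hasFDerivAt
  have h2 : HasFDerivAt (fun z : P × V => f (y, z.2)) (fderiv ℝ f (y, z.2) ∘L
      (ContinuousLinearMap.inr ℝ M V) ∘L (ContinuousLinearMap.snd ℝ P V)) z := by
    refine HasFDerivAt.comp z (f.hasFDerivAt (y, z.2)) ?_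
    refine HasFDerivAt.congr_fderiv
      ((hasFDerivAt_const y z).prodMk (hasFDerivAt_snd (𝕜 := ℝ) (p := z))) ?_
    ext <;> simp
  exact ((h1.const_mul Complex.I).cexp).mul h2

theorem partialFourierDeriv_apply (B : P →L[ℝ] M →L[ℝ] ℝ) (f : 𝓢(M × V, ℂ))
    (z : P × V) (y : M) (w : P × V) :
    partialFourierDeriv B f z y w = Complex.exp (Complex.I * (B z.1 y : ℂ)) *
      (fderiv ℝ f (y, z.2) (0, w.2) + Complex.I * (B w.1 y : ℂ) * f (y, z.2)) := by
  simp [partialFourierDeriv]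
  ring

theorem norm_partialFourierDeriv_le (B : P →L[ℝ] M →L[ℝ] ℝ) (f : 𝓢(M × V, ℂ))
    (z : P × V) (y : M) :
    ‖partialFourierDeriv B f z y‖ ≤ ‖fderiv ℝ f (y, z.2)‖ + ‖B‖ * (‖y‖ * ‖f (y, z.2)‖) := by
  refine ContinuousLinearMap.opNorm_le_bound _ (by positivity) fun w => ?_
  rw [partialFourierDeriv_apply, norm_mul, norm_cexp_I_mul_ofReal, one_mul, add_mul]
  refine (norm_add_le _ _).trans (add_le_add ?_ ?_)
  · refine ((fderiv ℝ f (y, z.2)).le_opNorm _).trans ?_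
    gcongr
    rw [Prod.norm_mk, norm_zero, max_eq_right (norm_nonneg _)]
    exact norm_snd_le w
  · rw [norm_mul, norm_mul, Complex.norm_I, one_mul, Complex.norm_real]
    have h1 := B.le_opNorm₂ w.1 y
    have h2 : ‖w.1‖ ≤ ‖w‖ := norm_fst_le w
    calc _ ≤ ‖B‖ * ‖w.1‖ * ‖y‖ * ‖f (y, z.2)‖ := by gcongr
      _ ≤ ‖B‖ * ‖w‖ * ‖y‖ * ‖f (y, z.2)‖ := by gcongr
      _ = _ := by ring

theorem partialFourier_hasFDerivAt (μ : Measure M) [μ.IsAddHaarMeasure]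
    (B : P →L[ℝ] M →L[ℝ] ℝ) (f : 𝓢(M × V, ℂ)) (z : P × V) :
    HasFDerivAt (fun z : P × V => ∫ y, Complex.exp (Complex.I * (B z.1 y : ℂ)) * f (y, z.2) ∂μ)
      (∫ y, partialFourierDeriv B f z y ∂μ) z ∧
    Integrable (partialFourierDeriv B f z) μ := by
  obtain ⟨b₁, hb₁, h₁⟩ := exists_integrable_majorant μ (fderivCLM ℝ (M × V) ℂ f) 0
  obtain ⟨b₂, hb₂, h₂⟩ := exists_integrable_majorant μ f 1
  have hbound : ∀ y z, ‖partialFourierDeriv B f z y‖ ≤ b₁ y + ‖B‖ * b₂ y := by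
    intro y z
    refine (norm_partialFourierDeriv_le B f z y).trans ?_
    have h1 := h₁ y z.2
    have h2 := h₂ y z.2
    simp only [pow_zero, one_mul, fderivCLM_apply, pow_one] at h1 h2
    gcongr
  have hmeas : AEStronglyMeasurable (partialFourierDeriv B f z) μ := by
    refine Continuous.aestronglyMeasurable ?_
    have := f.continuous
    have : Continuous (fderiv ℝ f) := (fderivCLM ℝ (M × V) ℂ f).continuous
    unfold partialFourierDeriv
    fun_prop
  have hint : Integrable (fun y => b₁ y + ‖B‖ * b₂ y) μ := hb₁.add (hb₂.const_mul _)
  refine ⟨?_, hint.mono' hmeas (.of_forall fun y => hbound y z)⟩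
  refine hasFDerivAt_integral_of_dominated_of_fderiv_le (s := Set.univ) univ_mem
    (.of_forall fun z => ?_) ?_ hmeas (.of_forall fun y z _ => hbound y z) hint
    (.of_forall fun y z _ => partialFourier_hasFDerivAt_integrand B f z y)
  · exact (integrable_phase_mul_slice μ f (B z.1) z.2).aestronglyMeasurable
  · exact integrable_phase_mul_slice μ f (B z.1) z.2

/-- Multiplication of a Schwartz function by a linear functional. -/
theorem exists_linear_mul {E : Type*} [NormedAddCommGroup E] [NormedSpace ℝ E] (f : 𝓢(E, ℂ))
    (ℓ : E →L[ℝ] ℝ) : ∃ g : 𝓢(E, ℂ), ∀ x, g x = (ℓ x : ℂ) * f x := by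
  have h : (fun x => (ℓ x : ℂ)).HasTemperateGrowth :=
    (Complex.ofRealCLM ∘L ℓ).hasTemperateGrowth
  exact ⟨smulLeftCLM ℂ (fun x => (ℓ x : ℂ)) f, fun x => by simp [smulLeftCLM_apply_apply h]⟩

/-- Differentiating under the integral only changes the amplitude `f`, so partial Fourier integrals
form a class closed under directional derivatives, as `exists_schwartz_of_class` requires. -/
theorem partialFourier_fderiv_mem (μ : Measure M) [μ.IsAddHaarMeasure]
    (B : P →L[ℝ] M →L[ℝ] ℝ) (f : 𝓢(M × V, ℂ)) (w : P × V) :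
    ∃ g : 𝓢(M × V, ℂ), (∀ y v, g (y, v) = fderiv ℝ f (y, v) (0, w.2) +
      Complex.I * (B w.1 y : ℂ) * f (y, v)) ∧ ∀ z,
      fderiv ℝ (fun z : P × V => ∫ y, Complex.exp (Complex.I * (B z.1 y : ℂ)) * f (y, z.2) ∂μ) z w
        = ∫ y, Complex.exp (Complex.I * (B z.1 y : ℂ)) * g (y, z.2) ∂μ := by
  obtain ⟨g, hg⟩ := exists_linear_mul f (B w.1 ∘L ContinuousLinearMap.fst ℝ M V)
  have hg' : ∀ y v, (LineDeriv.lineDerivOp ((0 : M), w.2) f + Complex.I • g) (y, v) =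
      fderiv ℝ f (y, v) (0, w.2) + Complex.I * (B w.1 y : ℂ) * f (y, v) := by
    intro y v
    rw [add_apply, smul_apply, hg, lineDerivOp_apply_eq_fderiv, smul_eq_mul]
    simp [mul_assoc]
  refine ⟨_, hg', fun z => ?_⟩
  obtain ⟨h1, h2⟩ := partialFourier_hasFDerivAt μ B f z
  rw [h1.fderiv, ContinuousLinearMap.integral_apply h2]
  refine integral_congr_ae (.of_forall fun y => ?_)
  beta_reduce
  rw [partialFourierDeriv_apply, hg']

/-- Integration by parts: it converts multiplication by a frequency into a derivative of the
amplitude. -/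
theorem integral_phase_mul_fderiv (μ : Measure M) [μ.IsAddHaarMeasure]
    (φ : M →L[ℝ] ℝ) (f : 𝓢(M × V, ℂ)) (v : V) (y₀ : M) :
    ∫ y, Complex.exp (Complex.I * (φ y : ℂ)) * (LineDeriv.lineDerivOp (y₀, (0 : V)) f) (y, v) ∂μ =
      -(Complex.I * φ y₀ * ∫ y, Complex.exp (Complex.I * (φ y : ℂ)) * f (y, v) ∂μ) := by
  have hd1 : ∀ y, HasFDerivAt (fun y => Complex.exp (Complex.I * (φ y : ℂ)))
      (Complex.exp (Complex.I * (φ y : ℂ)) • Complex.I • (Complex.ofRealCLM ∘L φ)) y := by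
    intro y
    have h1 : HasFDerivAt (fun y => (φ y : ℂ)) (Complex.ofRealCLM ∘L φ) y :=
      (Complex.ofRealCLM ∘L φ).hasFDerivAt
    exact (h1.const_mul Complex.I).cexp
  have hd2 : ∀ y, HasFDerivAt (fun y => f (y, v))
      (fderiv ℝ f (y, v) ∘L ContinuousLinearMap.inl ℝ M V) y := by
    intro y
    refine HasFDerivAt.comp y (f.hasFDerivAt (y, v)) ?_
    refine HasFDerivAt.congr_fderiv ((hasFDerivAt_id y).prodMk (hasFDerivAt_const v y)) ?_
    ext <;> simp
  have e1 : ∀ y, fderiv ℝ (fun y => f (y, v)) y y₀ =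
      (LineDeriv.lineDerivOp (y₀, (0 : V)) f) (y, v) := by
    intro y
    rw [(hd2 y).fderiv, lineDerivOp_apply_eq_fderiv]
    rfl
  have e2 : ∀ y, fderiv ℝ (fun y => Complex.exp (Complex.I * (φ y : ℂ))) y y₀ =
      (Complex.I * φ y₀) * Complex.exp (Complex.I * (φ y : ℂ)) := by
    intro y
    rw [(hd1 y).fderiv]
    simp
    ring
  have hi := integrable_phase_mul_slice μ f φ v
  have h := integral_mul_fderiv_eq_neg_fderiv_mul_of_integrable (μ := μ) (v := y₀)
    (f := fun y => Complex.exp (Complex.I * (φ y : ℂ))) (g := fun y => f (y, v)) ?_ ?_ hi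
    (fun y _ => (hd1 y).differentiableAt) (fun y _ => (hd2 y).differentiableAt)
  · simp only [e1, e2] at h
    rw [h, ← integral_const_mul]
    simp only [mul_assoc]
  · simp only [e2, mul_assoc]
    simpa only [mul_assoc] using hi.const_mul (Complex.I * φ y₀)
  · simp only [e1]
    exact integrable_phase_mul_slice μ _ φ v

/-- The partial Fourier integral of a Schwartz function with respect to a pairing `B` of the
integration space with the space of frequencies is a Schwartz function. -/
theorem exists_partialFourier (μ : Measure M) [μ.IsAddHaarMeasure]
    (B : P →L[ℝ] M →L[ℝ] ℝ) (hB : ∀ ℓ : P →L[ℝ] ℝ, ∃ y₀, ∀ p, ℓ p = B p y₀)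
    (f : 𝓢(M × V, ℂ)) :
    ∃ g : 𝓢(P × V, ℂ), ∀ p v,
      g (p, v) = ∫ y, Complex.exp (Complex.I * (B p y : ℂ)) * f (y, v) ∂μ := by
  suffices h : ∃ g : 𝓢(P × V, ℂ), ∀ z,
      g z = ∫ y, Complex.exp (Complex.I * (B z.1 y : ℂ)) * f (y, z.2) ∂μ from
    h.imp fun g hg p v => hg (p, v)
  refine exists_schwartz_of_class (𝒞 := Set.range fun (f : 𝓢(M × V, ℂ)) (z : P × V) =>
    ∫ y, Complex.exp (Complex.I * (B z.1 y : ℂ)) * f (y, z.2) ∂μ) ?_ ?_ ?_ ⟨f, rfl⟩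
  · rintro _ ⟨f, rfl⟩
    obtain ⟨b, hb, hfb⟩ := exists_integrable_majorant μ f 0
    refine ⟨∫ y, b y ∂μ, fun z => norm_integral_le_of_norm_le hb (.of_forall fun y => ?_)⟩
    rw [norm_mul, norm_cexp_I_mul_ofReal]
    simpa using hfb y z.2
  · rintro _ ⟨f, rfl⟩ ℓ
    -- By `hB` the frequency part of `ℓ` is `B · y₀`, so multiplying by it amounts to replacing `f`
    -- by `i ∂f` along `y₀`; the part of `ℓ` in `v` multiplies the amplitude directly.
    obtain ⟨y₀, hy₀⟩ := hB (ℓ ∘L ContinuousLinearMap.inl ℝ P V)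
    obtain ⟨g, hg⟩ := exists_linear_mul f
      ((ℓ ∘L ContinuousLinearMap.inr ℝ P V) ∘L ContinuousLinearMap.snd ℝ M V)
    refine ⟨g + Complex.I • LineDeriv.lineDerivOp (y₀, (0 : V)) f, funext fun z => ?_⟩
    have hz : ℓ z = B z.1 y₀ + ℓ (0, z.2) := by
      rw [← hy₀]
      simp [← map_add]
    have e : ∀ y, Complex.exp (Complex.I * (B z.1 y : ℂ)) *
        (g + Complex.I • LineDeriv.lineDerivOp (y₀, (0 : V)) f) (y, z.2) =
        (ℓ (0, z.2) : ℂ) * (Complex.exp (Complex.I * (B z.1 y : ℂ)) * f (y, z.2)) +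
        Complex.I * (Complex.exp (Complex.I * (B z.1 y : ℂ)) *
          (LineDeriv.lineDerivOp (y₀, (0 : V)) f) (y, z.2)) := by
      intro y
      rw [add_apply, smul_apply, hg, smul_eq_mul]
      simp
      ring
    simp only [e]
    rw [integral_add ((integrable_phase_mul_slice μ f _ _).const_mul _)
      ((integrable_phase_mul_slice μ _ _ _).const_mul _), integral_const_mul, integral_const_mul,
      integral_phase_mul_fderiv, hz]
    push_cast
    linear_combination (-(B z.1 y₀ : ℂ) *
      ∫ y, Complex.exp (Complex.I * (B z.1 y : ℂ)) * f (y, z.2) ∂μ) * Complex.I_mul_I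
  · rintro _ ⟨f, rfl⟩
    refine ⟨fun z => (partialFourier_hasFDerivAt μ B f z).1.differentiableAt, fun w => ?_⟩
    obtain ⟨g, -, hg⟩ := partialFourier_fderiv_mem μ B f w
    exact ⟨g, funext fun z => (hg z).symm⟩

/-- Integrating a Schwartz function over one of its variables gives a Schwartz function. -/
theorem exists_partialIntegral (μ : Measure M) [μ.IsAddHaarMeasure] (f : 𝓢(M × V, ℂ)) :
    ∃ g : 𝓢(V, ℂ), ∀ v, g v = ∫ y, f (y, v) ∂μ := by
  -- With a zero-dimensional frequency space the phase is 1 and the partial Fourier integral is a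
  -- plain integral.
  obtain ⟨g, hg⟩ := exists_partialFourier (P := Fin 0 → ℝ) μ 0
    (fun ℓ => ⟨0, fun p => by rw [Subsingleton.elim p 0, map_zero, map_zero]⟩) f
  obtain ⟨h, hh⟩ := exists_comp_injective g (LinearMap.inr ℝ (Fin 0 → ℝ) V)
    LinearMap.inr_injective
  exact ⟨h, fun v => by simp [hh, hg]⟩

theorem fderiv_partialIntegral (μ : Measure M) [μ.IsAddHaarMeasure] (f : 𝓢(M × V, ℂ)) (v w : V) :
    fderiv ℝ (fun v => ∫ y, f (y, v) ∂μ) v w =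
      ∫ y, (LineDeriv.lineDerivOp ((0 : M), w) f) (y, v) ∂μ := by
  obtain ⟨h1, h2⟩ := partialFourier_hasFDerivAt (P := Fin 0 → ℝ) μ 0 f (0, v)
  have h3 := h1.comp v ((hasFDerivAt_const (0 : Fin 0 → ℝ) v).prodMk (hasFDerivAt_id (𝕜 := ℝ) v))
  have h4 : ((fun z : (Fin 0 → ℝ) × V => ∫ y, Complex.exp (Complex.I *
      (((0 : (Fin 0 → ℝ) →L[ℝ] M →L[ℝ] ℝ) z.1 y : ℝ) : ℂ)) * f (y, z.2) ∂μ) ∘ Prod.mk 0) =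
      fun v => ∫ y, f (y, v) ∂μ := by
    funext v
    simp
  rw [h4] at h3
  rw [h3.fderiv]
  simp only [ContinuousLinearMap.comp_apply]
  rw [ContinuousLinearMap.integral_apply h2]
  refine integral_congr_ae (.of_forall fun y => ?_)
  simp [partialFourierDeriv_apply, lineDerivOp_apply_eq_fderiv]

/-- The restriction `y ↦ K (v, y)` of a Schwartz function on a product. -/
def slice (K : 𝓢(V × M, ℂ)) (v : V) : 𝓢(M, ℂ) :=
  compCLMOfAntilipschitz ℝ (K := 1) (g := fun y : M => (v, y))
    (by
      have h : (fun y : M => (v, y)) = fun y => (v, (0 : M)) + ContinuousLinearMap.inr ℝ V M y := by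
        funext y
        simp
      rw [h]
      exact (Function.HasTemperateGrowth.const _).add
        (ContinuousLinearMap.inr ℝ V M).hasTemperateGrowth)
    (fun x y => by simp [Prod.edist_eq]) K

@[simp]
theorem slice_apply (K : 𝓢(V × M, ℂ)) (v : V) (y : M) : slice K v y = K (v, y) := rfl

end Partial

end SchwartzMap

/-! ### Fourier inversion at the origin for spaces in duality -/

section FourierInversion

open scoped FourierTransform

variable {E F : Type*} [NormedAddCommGroup E] [NormedSpace ℝ E] [FiniteDimensional ℝ E]
  [MeasurableSpace E] [BorelSpace E] [NormedAddCommGroup F] [NormedSpace ℝ F]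
  [FiniteDimensional ℝ F] [MeasurableSpace F] [BorelSpace F]

/-- The change of variables along a linear isomorphism for Haar measures. -/
theorem exists_integral_comp_linearEquiv (μ : Measure E) [μ.IsAddHaarMeasure] (ν : Measure F)
    [ν.IsAddHaarMeasure] (e : E ≃L[ℝ] F) :
    ∃ c : ℝ, 0 < c ∧ (∀ h : F → ℂ, Integrable h ν → Integrable (fun x => h (e x)) μ) ∧
      ∀ h : F → ℂ, ∫ x, h (e x) ∂μ = c * ∫ y, h y ∂ν := by
  have := FiniteDimensional.proper_real F
  have hm := Measure.isAddLeftInvariant_eq_smul (μ.map e) ν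
  have hc := Measure.addHaarScalarFactor_pos_of_isAddHaarMeasure (μ.map e) ν
  set c := (μ.map e).addHaarScalarFactor ν
  have hme : MeasurableEmbedding e := e.toHomeomorph.measurableEmbedding
  refine ⟨c, by exact_mod_cast hc, fun h hh => ?_, fun h => ?_⟩
  · have : Integrable h (μ.map e) := by
      rw [hm]
      exact hh.smul_measure_nnreal
    exact (hme.integrable_map_iff).1 this
  · rw [← hme.integral_map, hm, integral_smul_nnreal_measure]
    rfl

/-- Fourier inversion at the origin for two spaces in duality. -/
theorem exists_fourier_inversion_zero (μ : Measure E) [μ.IsAddHaarMeasure] (σ : Measure F)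
    [σ.IsAddHaarMeasure] (B : E →L[ℝ] F →L[ℝ] ℝ) (hB : ∀ x, (∀ y, B x y = 0) → x = 0)
    (hdim : Module.finrank ℝ E = Module.finrank ℝ F) :
    ∃ Δ : ℝ, 0 < Δ ∧ ∀ ρ : 𝓢(F, ℂ),
      (∀ x, Integrable (fun y => ρ y * Complex.exp (Complex.I * (B x y : ℂ))) σ) ∧
      Integrable (fun x => ∫ y, ρ y * Complex.exp (Complex.I * (B x y : ℂ)) ∂σ) μ ∧
      ∫ x, (∫ y, ρ y * Complex.exp (Complex.I * (B x y : ℂ)) ∂σ) ∂μ = ρ 0 * (Δ : ℂ) := by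
  let H := EuclideanSpace ℝ (Fin (Module.finrank ℝ F))
  let e : F ≃L[ℝ] H := ContinuousLinearEquiv.ofFinrankEq (by simp [H])
  -- The factor `-(2π)⁻¹` matches the kernel `exp (-2πi ⟨v, w⟩)` of `𝓕`, so the inner integral
  -- becomes `𝓕 f` at `a x`.
  let a : E →ₗ[ℝ] H :=
    { toFun := fun x => (InnerProductSpace.toDual ℝ H).symm
        ((-(2 * Real.pi)⁻¹) • (B x ∘L (e.symm : H →L[ℝ] F)))
      map_add' := fun x y => by
        rw [← map_add]
        congr 1
        ext
        simp
      map_smul' := fun r x => by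
        simp only [RingHom.id_apply]
        rw [← LinearIsometryEquiv.map_smul]
        congr 1
        ext
        simp
        ring }
  have ha : ∀ x v, (inner ℝ v (a x) : ℝ) = -(2 * Real.pi)⁻¹ * B x (e.symm v) := by
    intro x v
    rw [real_inner_comm]
    exact InnerProductSpace.toDual_symm_apply
  have hinj : Function.Injective a := by
    refine (injective_iff_map_eq_zero a).2 fun x hx => hB x fun y => ?_
    have := ha x (e y)
    rw [hx, inner_zero_right, e.symm_apply_apply] at this
    have hp : -(2 * Real.pi)⁻¹ ≠ 0 := by simp [Real.pi_ne_zero]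
    exact (mul_eq_zero.1 this.symm).resolve_left hp
  let a' : E ≃L[ℝ] H := (LinearEquiv.ofInjectiveOfFinrankEq a hinj
    (by rw [hdim]; simp [H])).toContinuousLinearEquiv
  have ha' : ∀ x v, (inner ℝ v (a' x) : ℝ) = -(2 * Real.pi)⁻¹ * B x (e.symm v) := ha
  obtain ⟨c₁, hc₁, hi₁, h₁⟩ := exists_integral_comp_linearEquiv σ (volume : Measure H) e
  obtain ⟨c₂, hc₂, hi₂, h₂⟩ := exists_integral_comp_linearEquiv μ (volume : Measure H) a'
  -- `Δ` is the product of the Jacobians of `e` and `a'`; the powers of `2π` sit in `c₂`.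
  refine ⟨c₁ * c₂, by positivity, fun ρ => ?_⟩
  let f : 𝓢(H, ℂ) := SchwartzMap.compCLMOfContinuousLinearEquiv ℝ e.symm ρ
  have hinner : ∀ x, ∫ y, ρ y * Complex.exp (Complex.I * (B x y : ℂ)) ∂σ =
      c₁ * (𝓕 f) (a' x) := by
    intro x
    have := h₁ fun v => ρ (e.symm v) * Complex.exp (Complex.I * (B x (e.symm v) : ℂ))
    simp only [e.symm_apply_apply] at this
    rw [this, SchwartzMap.fourier_coe, Real.fourier_eq']
    congr 2
    funext v
    rw [ha', smul_eq_mul, mul_comm]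
    congr 2
    push_cast
    field_simp
  refine ⟨fun x => ?_, ?_, ?_⟩
  · refine (ρ.integrable (μ := σ)).mono (Continuous.aestronglyMeasurable ?_)
      (.of_forall fun y => ?_)
    · have := ρ.continuous
      fun_prop
    · rw [norm_mul, SchwartzMap.norm_cexp_I_mul_ofReal, mul_one]
  · simp only [hinner]
    exact (hi₂ _ (𝓕 f).integrable).const_mul _
  · simp only [hinner]
    rw [integral_const_mul, h₂]
    have : ρ 0 = ∫ w, (𝓕 f) w := by
      have h0 : f 0 = ρ 0 := by simp [f]
      rw [← h0]
      have h1 : (𝓕⁻ (𝓕 f)) 0 = f 0 := by rw [FourierTransform.fourierInv_fourier_eq f]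
      rw [← h1, SchwartzMap.fourierInv_coe, Real.fourierInv_eq']
      simp
    rw [this]
    push_cast
    ring

end FourierInversion

/-! ### Linear complements and the splitting of Haar measure -/

section Complement

variable {E : Type*} [NormedAddCommGroup E] [NormedSpace ℝ E] [FiniteDimensional ℝ E]
  [MeasurableSpace E] [BorelSpace E]

theorem isAddHaarMeasure_map_add {G N : Submodule ℝ E} (h : IsCompl G N) (σ : Measure G)
    [σ.IsAddHaarMeasure] (ν : Measure N) [ν.IsAddHaarMeasure] :
    (Measure.map (fun p : G × N => (p.1 : E) + (p.2 : E)) (σ.prod ν)).IsAddHaarMeasure :=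
  ((G.prodEquivOfIsCompl N h).toContinuousLinearEquiv).isAddHaarMeasure_map (σ.prod ν)

/-- A complement of a subspace carries a Haar measure that splits a given Haar measure. -/
theorem exists_measure_map_add_eq {G N : Submodule ℝ E} (h : IsCompl G N) (σ : Measure G)
    [σ.IsAddHaarMeasure] (μ : Measure E) [μ.IsAddHaarMeasure] :
    ∃ ν : Measure N, ν.IsAddHaarMeasure ∧
      Measure.map (fun p : G × N => (p.1 : E) + (p.2 : E)) (σ.prod ν) = μ := by
  have := FiniteDimensional.proper_real E
  let ν₀ : Measure N := Measure.addHaar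
  have := isAddHaarMeasure_map_add h σ ν₀
  have hm := Measure.isAddLeftInvariant_eq_smul μ
    (Measure.map (fun p : G × N => (p.1 : E) + (p.2 : E)) (σ.prod ν₀))
  have hc := Measure.addHaarScalarFactor_pos_of_isAddHaarMeasure μ
    (Measure.map (fun p : G × N => (p.1 : E) + (p.2 : E)) (σ.prod ν₀))
  refine ⟨_, Measure.IsAddHaarMeasure.nnreal_smul ν₀ hc.ne', ?_⟩
  rw [Measure.prod_smul_right, Measure.map_smul]
  exact hm.symm

/-- Haar measures on `N` differ by a scalar, which must be 1 because a compact neighbourhood has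
finite positive `μ`-measure. -/
theorem measure_eq_of_map_add_eq {G N : Submodule ℝ E} (σ : Measure G)
    [σ.IsAddHaarMeasure] (μ : Measure E) [μ.IsAddHaarMeasure] (ν ν' : Measure N)
    [ν.IsAddHaarMeasure] [ν'.IsAddHaarMeasure]
    (hν : Measure.map (fun p : G × N => (p.1 : E) + (p.2 : E)) (σ.prod ν) = μ)
    (hν' : Measure.map (fun p : G × N => (p.1 : E) + (p.2 : E)) (σ.prod ν') = μ) : ν = ν' := by
  have := FiniteDimensional.proper_real E
  have hm := Measure.isAddLeftInvariant_eq_smul ν ν'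
  set c := ν.addHaarScalarFactor ν'
  rw [hm, Measure.prod_smul_right, Measure.map_smul, hν'] at hν
  obtain ⟨K, hK, hK'⟩ := exists_compact_mem_nhds (0 : E)
  have h1 : μ K ≠ ⊤ := hK.measure_lt_top.ne
  have h2 : μ K ≠ 0 := (Measure.measure_pos_of_mem_nhds μ hK').ne'
  have h3 : (c : ENNReal) * μ K = 1 * μ K := by
    rw [one_mul]
    exact congrArg (fun m : Measure E => m K) hν
  have h4 : (c : ENNReal) = 1 := (ENNReal.mul_left_inj h2 h1).1 h3
  have h5 : c = 1 := by exact_mod_cast h4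
  rw [hm, h5, one_smul]

/-- Two complements of the same subspace are identified by projecting along that subspace. -/
theorem exists_complement_equiv {G N M : Submodule ℝ E} (hN : IsCompl G N) (hM : IsCompl G M) :
    ∃ (τ : N ≃L[ℝ] M) (g : N →L[ℝ] G), ∀ y : N, (y : E) = (g y : E) + (τ y : E) := by
  let τ : N →ₗ[ℝ] M := M.projectionOnto G hM.symm ∘ₗ N.subtype
  let g : N →ₗ[ℝ] G := G.projectionOnto M hM ∘ₗ N.subtype
  have hg : ∀ y : N, (y : E) = (g y : E) + (τ y : E) := fun y =>
    (Submodule.projection_add_projection_eq_self hM (y : E)).symm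
  have hinj : Function.Injective τ := by
    refine (injective_iff_map_eq_zero τ).2 fun y hy => ?_
    have h := hg y
    rw [hy, Submodule.coe_zero, add_zero] at h
    exact Subtype.ext (Submodule.disjoint_def.1 hN.disjoint y (h ▸ (g y).2) y.2)
  have hsurj : Function.Surjective τ := by
    intro z
    obtain ⟨⟨a, y⟩, hz, -⟩ := Submodule.existsUnique_add_of_isCompl_prod hN (z : E)
    refine ⟨y, ?_⟩
    have h : (z : E) - (τ y : E) = (a : E) + (g y : E) := by
      rw [← hz, hg y]
      simp only
      abel
    have h0 := Submodule.disjoint_def.1 hM.disjoint ((z : E) - (τ y : E))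
      (h ▸ G.add_mem a.2 (g y).2) (M.sub_mem z.2 (τ y).2)
    exact Subtype.ext (sub_eq_zero.1 h0).symm
  exact ⟨(LinearEquiv.ofBijective τ ⟨hinj, hsurj⟩).toContinuousLinearEquiv,
    LinearMap.toContinuousLinearMap g, hg⟩

/-- Replacing `N` by `M` shifts the `G`-component by `g y`. This shear preserves the product measure
because `σ` is translation invariant, so the two splittings of `μ` correspond. -/
theorem map_complement_equiv {G N M : Submodule ℝ E} (σ : Measure G)
    [σ.IsAddHaarMeasure] (μ : Measure E) [μ.IsAddHaarMeasure] (ν : Measure N)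
    [ν.IsAddHaarMeasure] (ν' : Measure M) [ν'.IsAddHaarMeasure]
    (hν : Measure.map (fun p : G × N => (p.1 : E) + (p.2 : E)) (σ.prod ν) = μ)
    (hν' : Measure.map (fun p : G × M => (p.1 : E) + (p.2 : E)) (σ.prod ν') = μ)
    (τ : N ≃L[ℝ] M) (g : N →L[ℝ] G) (hg : ∀ y : N, (y : E) = (g y : E) + (τ y : E)) :
    ν.map τ = ν' := by
  refine measure_eq_of_map_add_eq σ μ _ _ ?_ hν'
  have hshear : MeasurePreserving (fun p : N × G => (p.1, -g p.1 + p.2)) (ν.prod σ) (ν.prod σ) :=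
    (MeasurePreserving.id ν).skew_product (g := fun y x => -g y + x)
      (Continuous.measurable (by simp only [Function.uncurry_def]; fun_prop))
      (.of_forall fun y => map_add_left_eq_self σ (-g y))
  have hshear' : Measure.map (fun p : G × N => (-g p.2 + p.1, p.2)) (σ.prod ν) = σ.prod ν := by
    have h := (Measure.measurePreserving_swap.comp hshear).comp
      (Measure.measurePreserving_swap (μ := σ) (ν := ν))
    exact h.map_eq
  have hτ : Measurable τ := τ.continuous.measurable
  have hid : Measurable (id : G → G) := measurable_id
  have h1 : σ.prod (ν.map τ) = Measure.map (Prod.map id τ) (σ.prod ν) := by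
    conv_lhs => rw [← Measure.map_id (μ := σ)]
    exact Measure.map_prod_map σ ν hid hτ
  have hadd : Measurable fun p : G × M => (p.1 : E) + (p.2 : E) :=
    Continuous.measurable (by fun_prop)
  have hadd' : Measurable fun p : G × N => (p.1 : E) + (p.2 : E) :=
    Continuous.measurable (by fun_prop)
  have hs : Measurable fun p : G × N => (-g p.2 + p.1, p.2) := Continuous.measurable (by fun_prop)
  rw [h1, Measure.map_map hadd (hid.prodMap hτ), ← hν]
  conv_rhs => rw [← hshear', Measure.map_map hadd' hs]
  congr 1
  funext p
  simp only [Function.comp_apply, Prod.map, id_eq, Submodule.coe_add, Submodule.coe_neg, hg p.2]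
  abel

end Complement

/-! ### Symplectic linear algebra of a plane and its gauge surface -/

section Symplectic

variable {n : ℕ}

/-- The symplectic form as a continuous bilinear map. -/
def sympL (n : ℕ) : Phase n →L[ℝ] Phase n →L[ℝ] ℝ :=
  (LinearMap.mk₂ ℝ (symp (n := n))
    (fun X X' Y => by
      simp only [symp, ← Finset.sum_add_distrib]
      exact Finset.sum_congr rfl fun j _ => by simp; ring)
    (fun c X Y => by
      simp only [symp, Finset.smul_sum]
      exact Finset.sum_congr rfl fun j _ => by simp; ring)
    (fun X Y Y' => by
      simp only [symp, ← Finset.sum_add_distrib]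
      exact Finset.sum_congr rfl fun j _ => by simp; ring)
    (fun c X Y => by
      simp only [symp, Finset.smul_sum]
      exact Finset.sum_congr rfl fun j _ => by simp; ring)).toContinuousBilinearMap

@[simp]
theorem sympL_apply (X Y : Phase n) : sympL n X Y = symp X Y := rfl

theorem symp_add_right (X Y Z : Phase n) : symp X (Y + Z) = symp X Y + symp X Z :=
  (sympL n X).map_add Y Z

theorem symp_neg_left (X Y : Phase n) : symp (-X) Y = -symp X Y := by
  simp [← sympL_apply]

theorem symp_neg_right (X Y : Phase n) : symp X (-Y) = -symp X Y := (sympL n X).map_neg Y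

theorem symp_swap (X Y : Phase n) : symp X Y = -symp Y X := by
  simp only [symp, ← Finset.sum_neg_distrib]
  exact Finset.sum_congr rfl fun j _ => by ring

/-- The symplectic orthogonal complement of a plane. -/
def sympOrth (L : Submodule ℝ (Phase n)) : Submodule ℝ (Phase n) where
  carrier := {Z | ∀ X ∈ L, symp X Z = 0}
  add_mem' := fun {Y Z} hY hZ X hX => by rw [symp_add_right, hY X hX, hZ X hX, add_zero]
  zero_mem' := fun X _ => (sympL n X).map_zero
  smul_mem' := fun c Z hZ X hX => by
    rw [← sympL_apply, map_smul, sympL_apply, hZ X hX, smul_zero]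

variable {k : ℕ} {L G : Submodule ℝ (Phase n)}

/-- Isotropy of `L` kills the pairing of `X` with `L`, so nondegeneracy on `L ⊔ G` is seen by `G`
alone. -/
theorem IsGaugeSurface.eq_zero_of_symp_left (hL : IsIsotropicPlane k L) (hG : IsGaugeSurface k L G)
    {X : Phase n} (hX : X ∈ L) (h : ∀ Y ∈ G, symp X Y = 0) : X = 0 := by
  refine hG.2 X (Submodule.mem_sup_left hX) fun W hW => ?_
  obtain ⟨a, ha, b, hb, rfl⟩ := Submodule.mem_sup.1 hW
  rw [symp_add_right, hL.2 X hX a ha, h b hb, add_zero]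

theorem IsGaugeSurface.eq_zero_of_symp_right (hG : IsGaugeSurface k L G)
    {Y : Phase n} (hY : Y ∈ G) (h : ∀ X ∈ L, symp X Y = 0) : Y = 0 := by
  refine hG.2 Y (Submodule.mem_sup_right hY) fun W hW => ?_
  obtain ⟨a, ha, b, hb, rfl⟩ := Submodule.mem_sup.1 hW
  rw [symp_add_right, symp_swap Y a, h a ha, hG.1.2 Y hY b hb, neg_zero, add_zero]

/-- A gauge surface is a complement of the symplectic orthogonal complement. -/
theorem IsGaugeSurface.isCompl_sympOrth (hL : IsIsotropicPlane k L) (hG : IsGaugeSurface k L G) :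
    IsCompl G (sympOrth L) := by
  let A : G →ₗ[ℝ] Module.Dual ℝ L :=
    { toFun := fun Y => ((sympL n).flip Y : Phase n →ₗ[ℝ] ℝ) ∘ₗ L.subtype
      map_add' := fun Y Z => by ext; simp
      map_smul' := fun c Y => by ext X; simp }
  have hA : ∀ (Y : G) (X : L), A Y X = symp (X : Phase n) (Y : Phase n) := fun _ _ => rfl
  have hinj : Function.Injective A := by
    refine (injective_iff_map_eq_zero A).2 fun Y hY => Subtype.ext ?_
    refine hG.eq_zero_of_symp_right Y.2 fun X hX => ?_
    rw [← hA Y ⟨X, hX⟩, hY, LinearMap.zero_apply]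
  -- Equal dimensions give surjectivity, so any `Z` has the same pairing with `L` as some `Y ∈ G`,
  -- and `Z - Y` is orthogonal to `L`.
  have hsurj : Function.Surjective A :=
    (LinearMap.injective_iff_surjective_of_finrank_eq_finrank
      (by rw [Subspace.dual_finrank_eq, hL.1, hG.1.1])).1 hinj
  rw [isCompl_iff, Submodule.disjoint_def, codisjoint_iff, Submodule.eq_top_iff']
  refine ⟨fun Y hY hY' => hG.eq_zero_of_symp_right hY hY', fun Z => ?_⟩
  obtain ⟨Y, hY⟩ := hsurj (((sympL n).flip Z : Phase n →ₗ[ℝ] ℝ) ∘ₗ L.subtype)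
  refine Submodule.mem_sup.2 ⟨Y, Y.2, Z - Y, fun X hX => ?_, by abel⟩
  have h := LinearMap.congr_fun hY ⟨X, hX⟩
  rw [hA] at h
  rw [sub_eq_add_neg, symp_add_right, symp_neg_right, h]
  simp

/-- The pairing of a plane with a gauge surface that the symplectic form defines. -/
def sympPairing (L G : Submodule ℝ (Phase n)) : L →L[ℝ] G →L[ℝ] ℝ :=
  (sympL n).bilinearComp L.subtypeL G.subtypeL

/-- Fourier inversion at the origin for a plane and a gauge surface. -/
theorem IsGaugeSurface.exists_inversion (hL : IsIsotropicPlane k L) (hG : IsGaugeSurface k L G)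
    (μ : Measure L) [μ.IsAddHaarMeasure] (σ : Measure G) [σ.IsAddHaarMeasure] :
    ∃ Δ : ℝ, 0 < Δ ∧ ∀ ρ : 𝓢(G, ℂ),
      (∀ X : L, Integrable (fun Y : G =>
        ρ Y * Complex.exp (Complex.I * (symp (X : Phase n) (Y : Phase n) : ℂ))) σ) ∧
      Integrable (fun X : L => ∫ Y : G,
        ρ Y * Complex.exp (Complex.I * (symp (X : Phase n) (Y : Phase n) : ℂ)) ∂σ) μ ∧
      ∫ X : L, (∫ Y : G,
        ρ Y * Complex.exp (Complex.I * (symp (X : Phase n) (Y : Phase n) : ℂ)) ∂σ) ∂μ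
          = ρ 0 * (Δ : ℂ) :=
  exists_fourier_inversion_zero μ σ (sympPairing L G)
    (fun X hX => Subtype.ext (hG.eq_zero_of_symp_left hL X.2 fun Y hY => hX ⟨Y, hY⟩))
    (by rw [hL.1, hG.1.1])

end Symplectic

open SchwartzMap (slice slice_apply tensor tensor_apply)

/-! ### Weyl operators on Schwartz families -/

section WeylFamilies

variable {n : ℕ} {D E : Type*} [NormedAddCommGroup D] [NormedSpace ℝ D] [FiniteDimensional ℝ D]
  [NormedAddCommGroup E] [NormedSpace ℝ E] [FiniteDimensional ℝ E]

theorem exists_conj_schwartz (f : 𝓢(E, ℂ)) : ∃ g : 𝓢(E, ℂ), ∀ x, g x = (starRingEnd ℂ) (f x) :=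
  ⟨SchwartzMap.postcompCLM (𝕜 := ℝ) (Complex.conjCLE : ℂ →L[ℝ] ℂ) f, fun _ => rfl⟩

theorem exists_temperate_mul {g : E → ℂ} (hg : g.HasTemperateGrowth) (f : 𝓢(E, ℂ)) :
    ∃ h : 𝓢(E, ℂ), ∀ x, h x = g x * f x :=
  ⟨SchwartzMap.smulLeftCLM ℂ g f, fun x => SchwartzMap.smulLeftCLM_apply_apply hg f x⟩

theorem weylPhase_comp_hasTemperateGrowth (A : D →ₗ[ℝ] Phase n) (g : D →ₗ[ℝ] Conf n) :
    (fun x => weylPhase (A x) (g x)).HasTemperateGrowth := by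
  let a : D →L[ℝ] Phase n := LinearMap.toContinuousLinearMap A
  let b : D →L[ℝ] Conf n := LinearMap.toContinuousLinearMap g
  have h1 : (fun x => innerSL ℝ (a x).1 (b x)).HasTemperateGrowth :=
    (innerSL ℝ).bilinear_hasTemperateGrowth
      (ContinuousLinearMap.fst ℝ _ _ ∘L a).hasTemperateGrowth b.hasTemperateGrowth
  have h2 : (fun x => innerSL ℝ (a x).1 (a x).2).HasTemperateGrowth :=
    (innerSL ℝ).bilinear_hasTemperateGrowth
      (ContinuousLinearMap.fst ℝ _ _ ∘L a).hasTemperateGrowth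
      (ContinuousLinearMap.snd ℝ _ _ ∘L a).hasTemperateGrowth
  have h3 : (fun x => dotp (A x).1 (g x) - dotp (A x).1 (A x).2 / 2).HasTemperateGrowth := by
    have h := h1.sub (h2.mul (Function.HasTemperateGrowth.const (2⁻¹ : ℝ)))
    convert h using 2 with x
    simp [dotp_eq_inner, a, b, div_eq_mul_inv]
  exact expI_hasTemperateGrowth.comp h3

theorem norm_weylPhase (X : Phase n) (ξ : Conf n) : ‖weylPhase X ξ‖ = 1 :=
  SchwartzMap.norm_cexp_I_mul_ofReal _

theorem weylPhase_eq (X : Phase n) (ξ : Conf n) :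
    weylPhase X ξ = Complex.exp (Complex.I * (inner ℝ X.1 ξ : ℝ)) * weylPhase X 0 := by
  simp only [weylPhase, ← Complex.exp_add, dotp_eq_inner, inner_zero_right]
  congr 1
  push_cast
  ring

/-- The Schwartz function `(d, η) ↦ F d * (exp (i Ω(A d)) ψ)(η)`. -/
theorem exists_weyl_family (F : 𝓢(D, ℂ)) (A : D →ₗ[ℝ] Phase n) (ψ : 𝓢(Conf n, ℂ)) :
    ∃ K : 𝓢(D × Conf n, ℂ), ∀ d, slice K d = F d • weyl (A d) ψ := by
  let T : D × Conf n →ₗ[ℝ] D × Conf n :=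
    (LinearMap.fst ℝ D (Conf n)).prod (LinearMap.snd ℝ D (Conf n) -
      LinearMap.snd ℝ (Conf n) (Conf n) ∘ₗ A ∘ₗ LinearMap.fst ℝ D (Conf n))
  have hT : Function.Injective T := by
    refine (injective_iff_map_eq_zero T).2 fun z hz => ?_
    have h1 : z.1 = 0 := congrArg Prod.fst hz
    have h2 : z.2 - (A z.1).2 = 0 := congrArg Prod.snd hz
    rw [h1, map_zero, Prod.snd_zero, sub_zero] at h2
    exact Prod.ext h1 h2
  obtain ⟨K, hK⟩ := SchwartzMap.exists_comp_injective (tensor F ψ) T hT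
  have hg := weylPhase_comp_hasTemperateGrowth (A ∘ₗ LinearMap.fst ℝ D (Conf n))
    (LinearMap.snd ℝ D (Conf n))
  obtain ⟨K', hK'⟩ := exists_temperate_mul hg K
  refine ⟨K', fun d => ?_⟩
  ext η
  rw [slice_apply, hK', hK, smul_apply, weyl_apply]
  simp [T]
  ring

/-- A single function viewed as a family over a point, so that results on families cover it. -/
theorem exists_const_family (ψ : 𝓢(Conf n, ℂ)) :
    ∃ K : 𝓢((Fin 0 → ℝ) × Conf n, ℂ), ∀ v, slice K v = ψ := by
  obtain ⟨K, hK⟩ := SchwartzMap.exists_comp_injective ψ (LinearMap.snd ℝ (Fin 0 → ℝ) (Conf n))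
    fun x y h => Prod.ext (Subsingleton.elim _ _) h
  exact ⟨K, fun v => by ext η; simp [hK]⟩

variable {V₁ V₂ : Type*} [NormedAddCommGroup V₁] [NormedSpace ℝ V₁] [FiniteDimensional ℝ V₁]
  [NormedAddCommGroup V₂] [NormedSpace ℝ V₂] [FiniteDimensional ℝ V₂]

/-- Matrix elements of the Weyl operators between Schwartz families are Schwartz functions. -/
theorem exists_matrixElement_family (K₁ : 𝓢(V₁ × Conf n, ℂ)) (K₂ : 𝓢(V₂ × Conf n, ℂ)) :
    ∃ Φ : 𝓢(Phase n × (V₁ × V₂), ℂ), ∀ X v₁ v₂,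
      Φ (X, (v₁, v₂)) = innerS (slice K₁ v₁) (weyl X (slice K₂ v₂)) := by
  obtain ⟨C₁, hC₁⟩ := exists_conj_schwartz K₁
  -- This arranges the arguments so that the partial Fourier transform in `η` creates the dependence
  -- on the momentum `P`, while `Q` enters through the shift `η - Q`.
  let T : Conf n × (Conf n × (V₁ × V₂)) →ₗ[ℝ] (V₁ × Conf n) × (V₂ × Conf n) :=
    { toFun := fun z => ((z.2.2.1, z.1), (z.2.2.2, z.1 - z.2.1))
      map_add' := fun x y => by
        simp only [Prod.fst_add, Prod.snd_add, Prod.mk_add_mk, add_sub_add_comm]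
      map_smul' := fun c x => by
        simp only [Prod.smul_fst, Prod.smul_snd, Prod.smul_mk, smul_sub, RingHom.id_apply] }
  have hT : Function.Injective T := by
    refine (injective_iff_map_eq_zero T).2 ?_
    rintro ⟨η, Q, v₁, v₂⟩ hz
    simp only [T, LinearMap.coe_mk, AddHom.coe_mk, Prod.mk_eq_zero] at hz
    obtain ⟨⟨h1, h2⟩, h3, h4⟩ := hz
    rw [h2, zero_sub, neg_eq_zero] at h4
    simp [h1, h2, h3, h4]
  obtain ⟨f, hf⟩ := SchwartzMap.exists_comp_injective (tensor C₁ K₂) T hT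
  obtain ⟨J, hJ⟩ := SchwartzMap.exists_partialFourier (P := Conf n) volume (innerSL ℝ)
    (fun ℓ => ⟨(InnerProductSpace.toDual ℝ (Conf n)).symm ℓ, fun p => by
      rw [innerSL_apply_apply, real_inner_comm, InnerProductSpace.toDual_symm_apply]⟩) f
  let T' : Phase n × (V₁ × V₂) →ₗ[ℝ] Conf n × (Conf n × (V₁ × V₂)) :=
    (LinearEquiv.prodAssoc ℝ (Conf n) (Conf n) (V₁ × V₂)).toLinearMap
  obtain ⟨J', hJ'⟩ := SchwartzMap.exists_comp_injective J T'
    (LinearEquiv.prodAssoc ℝ (Conf n) (Conf n) (V₁ × V₂)).injective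
  -- The remaining factor `exp (-i P·Q/2)` does not involve `η` and has temperate growth.
  have hg := weylPhase_comp_hasTemperateGrowth (LinearMap.fst ℝ (Phase n) (V₁ × V₂)) 0
  obtain ⟨Φ, hΦ⟩ := exists_temperate_mul hg J'
  refine ⟨Φ, fun X v₁ v₂ => ?_⟩
  rw [hΦ, hJ']
  change weylPhase X 0 * J (X.1, (X.2, (v₁, v₂))) = _
  rw [hJ, innerS, ← integral_const_mul]
  refine integral_congr_ae (.of_forall fun η => ?_)
  beta_reduce
  rw [hf, weyl_apply, slice_apply, slice_apply, tensor_apply, hC₁, weylPhase_eq X η,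
    innerSL_apply_apply]
  simp only [T, LinearMap.coe_mk, AddHom.coe_mk]
  ring

end WeylFamilies

theorem isNegInvariant_of_finiteDimensional {E : Type*} [NormedAddCommGroup E] [NormedSpace ℝ E]
    [FiniteDimensional ℝ E] [MeasurableSpace E] [BorelSpace E] (μ : Measure E)
    [μ.IsAddHaarMeasure] : μ.IsNegInvariant := by
  have := FiniteDimensional.proper_real E
  infer_instance

/-! ### Unitarity and commutation of the Weyl operators -/

section InnerS

variable {n : ℕ}

theorem integrable_conj_mul (φ ψ : 𝓢(Conf n, ℂ)) :
    Integrable fun ξ => (starRingEnd ℂ) (φ ξ) * ψ ξ := by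
  obtain ⟨h, hh⟩ := exists_temperate_mul (conjS φ).hasTemperateGrowth ψ
  exact (h.integrable (μ := volume)).congr (.of_forall hh)

theorem innerS_add_left (φ φ' ψ : 𝓢(Conf n, ℂ)) :
    innerS (φ + φ') ψ = innerS φ ψ + innerS φ' ψ := by
  simp only [innerS, add_apply, map_add, add_mul]
  exact integral_add (integrable_conj_mul φ ψ) (integrable_conj_mul φ' ψ)

theorem innerS_smul_left (c : ℂ) (φ ψ : 𝓢(Conf n, ℂ)) :
    innerS (c • φ) ψ = (starRingEnd ℂ) c * innerS φ ψ := by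
  simp only [innerS, smul_apply, smul_eq_mul, map_mul, mul_assoc]
  exact integral_const_mul _ _

theorem innerS_conj_symm (φ ψ : 𝓢(Conf n, ℂ)) : (starRingEnd ℂ) (innerS ψ φ) = innerS φ ψ := by
  rw [innerS, innerS, ← integral_conj]
  refine integral_congr_ae (.of_forall fun ξ => ?_)
  simp [mul_comm]

theorem innerS_smul_right (c : ℂ) (φ ψ : 𝓢(Conf n, ℂ)) :
    innerS φ (c • ψ) = c * innerS φ ψ := by
  rw [← innerS_conj_symm, innerS_smul_left, map_mul, innerS_conj_symm, Complex.conj_conj]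

theorem innerS_weyl_weyl (X : Phase n) (φ ψ : 𝓢(Conf n, ℂ)) :
    innerS (weyl X φ) (weyl X ψ) = innerS φ ψ := by
  rw [innerS, innerS,
    ← integral_sub_right_eq_self (fun ξ => (starRingEnd ℂ) (φ ξ) * ψ ξ) X.2]
  refine integral_congr_ae (.of_forall fun ξ => ?_)
  beta_reduce
  rw [weyl_apply, weyl_apply, map_mul]
  have h : (starRingEnd ℂ) (weylPhase X ξ) * weylPhase X ξ = 1 := by
    rw [Complex.conj_mul', norm_weylPhase]
    simp
  linear_combination (starRingEnd ℂ) (φ (ξ - X.2)) * ψ (ξ - X.2) * h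

theorem symp_self (X : Phase n) : symp X X = 0 := by simp [symp]

theorem weyl_neg_weyl (X : Phase n) (ψ : 𝓢(Conf n, ℂ)) : weyl (-X) (weyl X ψ) = ψ := by
  rw [weyl_weyl, symp_neg_left, symp_self]
  simp [weyl_zero]

theorem innerS_weyl_right (X : Phase n) (φ ψ : 𝓢(Conf n, ℂ)) :
    innerS φ (weyl X ψ) = innerS (weyl (-X) φ) ψ := by
  rw [← innerS_weyl_weyl (-X), weyl_neg_weyl]

/-- The commutation relation of the Weyl operators. -/
theorem weyl_swap (X Y : Phase n) (ψ : 𝓢(Conf n, ℂ)) :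
    weyl X (weyl Y ψ) = Complex.exp (Complex.I * (symp X Y : ℂ)) • weyl Y (weyl X ψ) := by
  rw [weyl_weyl, weyl_weyl Y X, smul_smul, ← Complex.exp_add, add_comm Y X, symp_swap Y X]
  congr 2
  push_cast
  ring

theorem weyl_comm {X Y : Phase n} (h : symp X Y = 0) (ψ : 𝓢(Conf n, ℂ)) :
    weyl X (weyl Y ψ) = weyl Y (weyl X ψ) := by
  rw [weyl_swap, h]
  simp

theorem weyl_add {X Y : Phase n} (h : symp X Y = 0) (ψ : 𝓢(Conf n, ℂ)) :
    weyl X (weyl Y ψ) = weyl (X + Y) ψ := by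
  rw [weyl_weyl, h]
  simp

theorem conjS_conjS (ψ : 𝓢(Conf n, ℂ)) : conjS (conjS ψ) = ψ := by
  ext ξ
  simp [conjS_apply]

theorem conjS_weyl (X : Phase n) (ψ : 𝓢(Conf n, ℂ)) :
    conjS (weyl (X.1, -X.2) ψ) = weyl (-X) (conjS ψ) := by
  ext ξ
  rw [conjS_apply, weyl_apply, weyl_apply, conjS_apply, map_mul]
  congr 1
  · rw [weylPhase, weylPhase, ← Complex.exp_conj, map_mul, Complex.conj_I, Complex.conj_ofReal]
    congr 1
    simp only [dotp_eq_inner, inner_neg_right, Prod.fst_neg, Prod.snd_neg, inner_neg_left]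
    push_cast
    ring

theorem integral_mul_eq_innerS (φ ψ : 𝓢(Conf n, ℂ)) : ∫ ξ, φ ξ * ψ ξ = innerS (conjS ψ) φ := by
  rw [innerS]
  refine integral_congr_ae (.of_forall fun ξ => ?_)
  simp [conjS_apply, mul_comm]

variable {D : Type*} [NormedAddCommGroup D] [NormedSpace ℝ D] [FiniteDimensional ℝ D]
  [MeasurableSpace D] [BorelSpace D]

/-- Integration of a Schwartz family commutes with the inner product. -/
theorem integral_innerS_slice (μ : Measure D) [μ.IsAddHaarMeasure] (φ J : 𝓢(Conf n, ℂ))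
    (K : 𝓢(D × Conf n, ℂ)) (hJ : ∀ η, J η = ∫ d, K (d, η) ∂μ) :
    ∫ d, innerS φ (slice K d) ∂μ = innerS φ J := by
  have := FiniteDimensional.proper_real D
  have hg : (fun z : D × Conf n => conjS φ z.2).HasTemperateGrowth :=
    (conjS φ).hasTemperateGrowth.comp (ContinuousLinearMap.snd ℝ D (Conf n)).hasTemperateGrowth
  obtain ⟨f, hf⟩ := exists_temperate_mul hg K
  have hfi : Integrable (Function.uncurry fun (d : D) (η : Conf n) =>
      (starRingEnd ℂ) (φ η) * K (d, η)) (μ.prod volume) :=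
    (f.integrable (μ := μ.prod volume)).congr (.of_forall hf)
  simp only [innerS, slice_apply]
  rw [integral_integral_swap hfi]
  refine integral_congr_ae (.of_forall fun η => ?_)
  beta_reduce
  rw [integral_const_mul, hJ]

end InnerS

/-! ### The form averaged over an isotropic plane -/

section AlgInner

variable {n k : ℕ} {L : Submodule ℝ (Phase n)} (μ : Measure L) [μ.IsAddHaarMeasure]

theorem exists_matrixElement_family_restrict {V₁ V₂ : Type*} [NormedAddCommGroup V₁]
    [NormedSpace ℝ V₁] [FiniteDimensional ℝ V₁] [NormedAddCommGroup V₂] [NormedSpace ℝ V₂]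
    [FiniteDimensional ℝ V₂] (L : Submodule ℝ (Phase n))
    (K₁ : 𝓢(V₁ × Conf n, ℂ)) (K₂ : 𝓢(V₂ × Conf n, ℂ)) :
    ∃ Φ : 𝓢(L × (V₁ × V₂), ℂ), ∀ (X : L) v₁ v₂,
      Φ (X, (v₁, v₂)) = innerS (slice K₁ v₁) (weyl (X : Phase n) (slice K₂ v₂)) := by
  obtain ⟨Φ, hΦ⟩ := exists_matrixElement_family K₁ K₂
  obtain ⟨Φ', hΦ'⟩ := SchwartzMap.exists_comp_injective Φ (L.subtype.prodMap LinearMap.id)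
    (L.subtype_injective.prodMap Function.injective_id)
  exact ⟨Φ', fun X v₁ v₂ => by rw [hΦ', ← hΦ]; rfl⟩

theorem exists_matrixElement_restrict (L : Submodule ℝ (Phase n)) (φ ψ : 𝓢(Conf n, ℂ)) :
    ∃ a : 𝓢(L, ℂ), ∀ X : L, a X = innerS φ (weyl (X : Phase n) ψ) := by
  obtain ⟨K₁, hK₁⟩ := exists_const_family φ
  obtain ⟨K₂, hK₂⟩ := exists_const_family ψ
  obtain ⟨Φ, hΦ⟩ := exists_matrixElement_family_restrict L K₁ K₂
  obtain ⟨a, ha⟩ := SchwartzMap.exists_comp_injective Φ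
    (LinearMap.inl ℝ L ((Fin 0 → ℝ) × (Fin 0 → ℝ))) LinearMap.inl_injective
  refine ⟨a, fun X => ?_⟩
  rw [ha, ← hK₁ 0, ← hK₂ 0, ← hΦ]
  rfl

theorem integrable_matrixElement (φ ψ : 𝓢(Conf n, ℂ)) :
    Integrable (fun X : L => innerS φ (weyl (X : Phase n) ψ)) μ := by
  obtain ⟨a, ha⟩ := exists_matrixElement_restrict L φ ψ
  exact (a.integrable (μ := μ)).congr (.of_forall ha)

theorem algInner_add_left (φ φ' ψ : 𝓢(Conf n, ℂ)) :
    algInner μ (φ + φ') ψ = algInner μ φ ψ + algInner μ φ' ψ := by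
  simp only [algInner, innerS_add_left]
  exact integral_add (integrable_matrixElement μ φ ψ) (integrable_matrixElement μ φ' ψ)

theorem algInner_smul_left (c : ℂ) (φ ψ : 𝓢(Conf n, ℂ)) :
    algInner μ (c • φ) ψ = (starRingEnd ℂ) c * algInner μ φ ψ := by
  simp only [algInner, innerS_smul_left]
  exact integral_const_mul _ _

/-- Conjugation replaces `X` by `-X`, and Haar measure is invariant under this reflection. -/
theorem algInner_conj_symm (φ ψ : 𝓢(Conf n, ℂ)) :
    (starRingEnd ℂ) (algInner μ ψ φ) = algInner μ φ ψ := by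
  have := isNegInvariant_of_finiteDimensional μ
  rw [algInner, algInner, ← integral_conj, ← integral_neg_eq_self]
  refine integral_congr_ae (.of_forall fun X => ?_)
  beta_reduce
  rw [innerS_conj_symm, innerS_weyl_right (X : Phase n), Submodule.coe_neg]

theorem etaMap_eq_algInner (ψ χ : 𝓢(Conf n, ℂ)) : etaMap μ ψ χ = algInner μ (conjS χ) ψ := by
  simp only [etaMap, algInner, integral_mul_eq_innerS]

/-- By isotropy the Weyl operators of `L` compose without a phase, so the extra factor is a
translation of the integration variable. -/
theorem algInner_weyl_right (hL : IsIsotropicPlane k L) (X : L) (φ ψ : 𝓢(Conf n, ℂ)) :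
    algInner μ φ (weyl (X : Phase n) ψ) = algInner μ φ ψ := by
  rw [algInner, algInner,
    ← integral_add_right_eq_self (fun Y : L => innerS φ (weyl (Y : Phase n) ψ)) X]
  refine integral_congr_ae (.of_forall fun Y => ?_)
  beta_reduce
  rw [weyl_add (hL.2 _ Y.2 _ X.2), Submodule.coe_add]

/-- Weyl operators of `L^⊥` commute with those of `L`, hence pass through the average and cancel by
unitarity. -/
theorem algInner_weyl_weyl {Z : Phase n} (hZ : Z ∈ sympOrth L) (φ ψ : 𝓢(Conf n, ℂ)) :
    algInner μ (weyl Z φ) (weyl Z ψ) = algInner μ φ ψ := by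
  rw [algInner, algInner]
  refine integral_congr_ae (.of_forall fun Y => ?_)
  beta_reduce
  rw [weyl_comm (hZ _ Y.2), innerS_weyl_weyl]

end AlgInner

/-- Schwartz functions on a product are integrable for the product of Haar measures. -/
theorem integrable_prod_schwartz {D E : Type*} [NormedAddCommGroup D] [NormedSpace ℝ D]
    [FiniteDimensional ℝ D] [MeasurableSpace D] [BorelSpace D] [NormedAddCommGroup E]
    [NormedSpace ℝ E] [FiniteDimensional ℝ E] [MeasurableSpace E] [BorelSpace E]
    (μ : Measure D) [μ.IsAddHaarMeasure] (ν : Measure E) [ν.IsAddHaarMeasure] (f : 𝓢(D × E, ℂ)) :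
    Integrable f (μ.prod ν) := by
  have := FiniteDimensional.proper_real D
  have := FiniteDimensional.proper_real E
  exact f.integrable

/-! ### Positivity of the averaged form -/

section PositiveType

variable {E : Type*} [NormedAddCommGroup E] [NormedSpace ℝ E] [FiniteDimensional ℝ E]

/-- There are Schwartz functions that equal one near a given point. -/
theorem exists_schwartz_eq_one_nhds (x₀ : E) :
    ∃ f : 𝓢(E, ℂ), ∀ᶠ x in 𝓝 x₀, f x = 1 := by
  let b : ContDiffBump x₀ := default
  have h1 : HasCompactSupport fun x => (b x : ℂ) :=
    b.hasCompactSupport.comp_left (g := fun t : ℝ => (t : ℂ)) Complex.ofReal_zero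
  have h2 : ContDiff ℝ ((⊤ : ℕ∞) : WithTop ℕ∞) fun x => (b x : ℂ) :=
    Complex.ofRealCLM.contDiff.comp b.contDiff
  refine ⟨h1.toSchwartzMap h2, ?_⟩
  filter_upwards [b.eventuallyEq_one] with x hx
  change (b x : ℂ) = 1
  rw [hx]
  simp

variable [MeasurableSpace E] [BorelSpace E] (μ : Measure E) [μ.IsAddHaarMeasure]

/-- The autocorrelation of a Schwartz function is a Schwartz function. -/
theorem exists_autocorrelation (χ : 𝓢(E, ℂ)) :
    ∃ c : 𝓢(E, ℂ), ∀ v, c v = ∫ x, (starRingEnd ℂ) (χ (x - v)) * χ x ∂μ := by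
  obtain ⟨χ', hχ'⟩ := exists_conj_schwartz χ
  let T : E × E →ₗ[ℝ] E × E :=
    (LinearMap.fst ℝ E E - LinearMap.snd ℝ E E).prod (LinearMap.fst ℝ E E)
  have hT : Function.Injective T := by
    refine (injective_iff_map_eq_zero T).2 fun z hz => ?_
    have h1 : z.1 - z.2 = 0 := congrArg Prod.fst hz
    have h2 : z.1 = 0 := congrArg Prod.snd hz
    rw [h2, zero_sub, neg_eq_zero] at h1
    exact Prod.ext h2 h1
  obtain ⟨f, hf⟩ := SchwartzMap.exists_comp_injective (tensor χ' χ) T hT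
  obtain ⟨c, hc⟩ := SchwartzMap.exists_partialIntegral μ f
  refine ⟨c, fun v => ?_⟩
  rw [hc]
  simp [hf, hχ', T]

theorem exists_autocorrelation_zero_pos :
    ∃ χ : 𝓢(E, ℂ), ∃ r : ℝ, 0 < r ∧ ∫ x, (starRingEnd ℂ) (χ x) * χ x ∂μ = (r : ℂ) := by
  obtain ⟨χ, hχ⟩ := exists_schwartz_eq_one_nhds (0 : E)
  have e : ∀ x, (starRingEnd ℂ) (χ x) * χ x = ((‖χ x‖ ^ 2 : ℝ) : ℂ) := fun x => by
    rw [Complex.conj_mul']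
    push_cast
    rfl
  refine ⟨χ, ∫ x, ‖χ x‖ ^ 2 ∂μ, ?_, ?_⟩
  · have hc : Continuous fun x => ‖χ x‖ ^ 2 := by
      have := χ.continuous
      fun_prop
    have hi : Integrable (fun x => ‖χ x‖ ^ 2) μ := by
      obtain ⟨χ', hχ'⟩ := exists_conj_schwartz χ
      obtain ⟨f, hf⟩ := exists_temperate_mul χ'.hasTemperateGrowth χ
      refine (f.integrable (μ := μ)).re.congr (.of_forall fun x => ?_)
      change (f x).re = _
      rw [hf, hχ', e, Complex.ofReal_re]
    refine integral_pos_of_integrable_nonneg_nonzero hc hi (fun x => by positivity) (x := 0) ?_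
    rw [hχ.self_of_nhds]
    simp
  · simp only [e]
    exact integral_ofReal

/-- The integral of a Schwartz function of positive type is nonnegative. -/
theorem re_integral_nonneg_of_positive_type (a : 𝓢(E, ℂ))
    (ha : ∀ χ : 𝓢(E, ℂ), 0 ≤ (∫ v, a v * ∫ x, (starRingEnd ℂ) (χ (x - v)) * χ x ∂μ ∂μ).re) :
    0 ≤ (∫ v, a v ∂μ).re := by
  obtain ⟨χ, r, hr, hχ⟩ := exists_autocorrelation_zero_pos μ
  obtain ⟨c, hc⟩ := exists_autocorrelation μ χ
  have hc0 : c 0 = (r : ℂ) := by simpa [hc] using hχ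
  -- Dilating `χ` by `t` dilates its autocorrelation by `t`, up to a positive Jacobian. As `t → 0`
  -- the weight `c (t • v)` flattens to the positive constant `c 0`.
  have h1 : ∀ t : ℝ, t ≠ 0 → 0 ≤ (∫ v, a v * c (t • v) ∂μ).re := by
    intro t ht
    obtain ⟨χt, hχt⟩ := SchwartzMap.exists_comp_injective χ (t • LinearMap.id)
      (fun x y h => smul_right_injective E ht (by simpa using h))
    have h := ha χt
    have e : ∀ v, ∫ x, (starRingEnd ℂ) (χt (x - v)) * χt x ∂μ =
        (|(t ^ Module.finrank ℝ E)⁻¹| : ℝ) * c (t • v) := by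
      intro v
      have h2 := Measure.integral_comp_smul μ
        (fun x => (starRingEnd ℂ) (χ (x - t • v)) * χ x) t
      rw [← hc (t • v), Complex.real_smul] at h2
      rw [← h2]
      simp [hχt, smul_sub]
    simp only [e, mul_left_comm (a _)] at h
    rw [integral_const_mul, Complex.re_ofReal_mul] at h
    exact nonneg_of_mul_nonneg_right h (by positivity)
  have hlim : Tendsto (fun m : ℕ => ∫ v, a v * c ((1 / ((m : ℝ) + 1)) • v) ∂μ) atTop
      (𝓝 (∫ v, a v * c 0 ∂μ)) := by
    refine tendsto_integral_of_dominated_convergence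
      (fun v => ‖a v‖ * (SchwartzMap.seminorm ℝ 0 0) c) (fun m => ?_)
      ((a.integrable (μ := μ)).norm.mul_const _) (fun m => .of_forall fun v => ?_)
      (.of_forall fun v => ?_)
    · refine Continuous.aestronglyMeasurable ?_
      have := a.continuous
      have := c.continuous
      fun_prop
    · rw [norm_mul]
      gcongr
      exact SchwartzMap.norm_le_seminorm ℝ c _
    · refine Tendsto.const_mul _ ((c.continuous.tendsto 0).comp ?_)
      have h := (tendsto_one_div_add_atTop_nhds_zero_nat (𝕜 := ℝ)).smul_const v
      simpa using h
  have h2 : 0 ≤ (∫ v, a v * c 0 ∂μ).re :=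
    ge_of_tendsto ((Complex.continuous_re.tendsto _).comp hlim)
      (.of_forall fun m => h1 _ (by positivity))
  rw [integral_mul_const, hc0, Complex.re_mul_ofReal] at h2
  exact nonneg_of_mul_nonneg_left h2 hr

end PositiveType

section AlgInnerNonneg

variable {n k : ℕ} {L : Submodule ℝ (Phase n)} (μ : Measure L) [μ.IsAddHaarMeasure]

theorem re_innerS_self_nonneg (ψ : 𝓢(Conf n, ℂ)) : 0 ≤ (innerS ψ ψ).re := by
  have e : ∀ x, (starRingEnd ℂ) (ψ x) * ψ x = ((‖ψ x‖ ^ 2 : ℝ) : ℂ) := fun x => by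
    rw [Complex.conj_mul']
    push_cast
    rfl
  have h : innerS ψ ψ = ((∫ x, ‖ψ x‖ ^ 2 : ℝ) : ℂ) := by
    simp only [innerS, e]
    exact integral_ofReal
  rw [h, Complex.ofReal_re]
  positivity

/-- The algebraic inner square is nonnegative. -/
theorem re_algInner_self_nonneg (hL : IsIsotropicPlane k L) (ψ : 𝓢(Conf n, ℂ)) :
    0 ≤ (algInner μ ψ ψ).re := by
  have := isNegInvariant_of_finiteDimensional μ
  obtain ⟨a, ha⟩ := exists_matrixElement_restrict L ψ ψ
  have h0 : algInner μ ψ ψ = ∫ X, a X ∂μ := by simp only [algInner, ha]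
  rw [h0]
  refine re_integral_nonneg_of_positive_type μ a fun χ => ?_
  obtain ⟨K, hK⟩ := exists_weyl_family χ L.subtype ψ
  -- `w` is the integral of `χ(X) exp (iΩ(X)) ψ` over `L`; its ordinary inner square is the
  -- expression whose sign is sought.
  obtain ⟨w, hw⟩ := SchwartzMap.exists_partialIntegral μ K
  -- The matrix element depends on `Y - X` only, because isotropy removes the Weyl phase.
  have h1 : ∀ X Y : L, innerS (slice K X) (slice K Y) =
      (starRingEnd ℂ) (χ X) * χ Y * a (Y - X) := by
    intro X Y
    have hXY : symp (-(X : Phase n)) (Y : Phase n) = 0 := by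
      rw [symp_neg_left, hL.2 _ X.2 _ Y.2, neg_zero]
    have h2 : innerS (weyl (X : Phase n) ψ) (weyl (Y : Phase n) ψ) = a (Y - X) := by
      rw [ha, ← innerS_weyl_weyl (-(X : Phase n)), weyl_neg_weyl, weyl_add hXY,
        Submodule.coe_sub, neg_add_eq_sub]
    rw [hK, hK, innerS_smul_left, innerS_smul_right]
    simp only [Submodule.coe_subtype, h2]
    ring
  obtain ⟨χ', hχ'⟩ := exists_conj_schwartz χ
  have hg : (fun z : L × L => χ' (z.1 - z.2)).HasTemperateGrowth :=
    χ'.hasTemperateGrowth.comp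
      (ContinuousLinearMap.fst ℝ L L - ContinuousLinearMap.snd ℝ L L).hasTemperateGrowth
  obtain ⟨f, hf⟩ := exists_temperate_mul hg (tensor χ a)
  have hfi : Integrable (Function.uncurry fun (Y V : L) =>
      (starRingEnd ℂ) (χ (Y - V)) * χ Y * a V) (μ.prod μ) := by
    refine (integrable_prod_schwartz μ μ f).congr (.of_forall fun z => ?_)
    simp [hf, hχ', Function.uncurry, mul_assoc]
  have h3 : innerS w w = ∫ V, a V * ∫ Y, (starRingEnd ℂ) (χ (Y - V)) * χ Y ∂μ ∂μ := by
    rw [← integral_innerS_slice μ w w K hw]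
    have h4 : ∀ Y : L, innerS w (slice K Y) =
        ∫ V, (starRingEnd ℂ) (χ (Y - V)) * χ Y * a V ∂μ := by
      intro Y
      rw [← innerS_conj_symm, ← integral_innerS_slice μ (slice K Y) w K hw, ← integral_conj]
      simp only [innerS_conj_symm]
      rw [← integral_sub_left_eq_self (fun X => innerS (slice K X) (slice K Y)) μ Y]
      simp only [h1, sub_sub_cancel]
    simp only [h4]
    rw [integral_integral_swap hfi]
    refine integral_congr_ae (.of_forall fun V => ?_)
    beta_reduce
    rw [integral_mul_const, mul_comm]
  rw [← h3]
  exact re_innerS_self_nonneg w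

end AlgInnerNonneg

/-! ### The Hilbert space and the distributions of its vectors -/

section Completion

variable {n k : ℕ} {L : Submodule ℝ (Phase n)}

/-- The Schwartz space with the seminorm of the algebraic inner product. -/
def PreDirac (_hL : IsIsotropicPlane k L) (_μ : Measure L) : Type := 𝓢(Conf n, ℂ)

variable (hL : IsIsotropicPlane k L) (μ : Measure L)

instance : AddCommGroup (PreDirac hL μ) := inferInstanceAs (AddCommGroup 𝓢(Conf n, ℂ))

instance : Module ℂ (PreDirac hL μ) := inferInstanceAs (Module ℂ 𝓢(Conf n, ℂ))

variable [μ.IsAddHaarMeasure]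

instance preDiracCore : PreInnerProductSpace.Core ℂ (PreDirac hL μ) where
  inner φ ψ := algInner (n := n) μ φ ψ
  conj_inner_symm φ ψ := algInner_conj_symm (n := n) μ φ ψ
  re_inner_nonneg ψ := re_algInner_self_nonneg (n := n) μ hL ψ
  add_left φ φ' ψ := algInner_add_left (n := n) μ φ φ' ψ
  smul_left φ ψ c := algInner_smul_left (n := n) μ c φ ψ

instance : SeminormedAddCommGroup (PreDirac hL μ) :=
  InnerProductSpace.Core.toSeminormedAddCommGroup (𝕜 := ℂ)

instance : InnerProductSpace ℂ (PreDirac hL μ) :=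
  InnerProductSpace.ofCore (preDiracCore hL μ)

/-- The Hilbert space completion of the Schwartz space modulo null vectors. -/
abbrev DiracHilbert : Type := UniformSpace.Completion (PreDirac hL μ)

/-- The canonical map from the Schwartz space to the Hilbert space. -/
def toH : 𝓢(Conf n, ℂ) →ₗ[ℂ] DiracHilbert hL μ :=
  (UniformSpace.Completion.toComplₗᵢ (𝕜 := ℂ) (E := PreDirac hL μ)).toLinearMap

theorem inner_toH (φ ψ : 𝓢(Conf n, ℂ)) :
    inner ℂ (toH hL μ φ) (toH hL μ ψ) = algInner μ φ ψ :=
  UniformSpace.Completion.inner_coe (𝕜 := ℂ) (E := PreDirac hL μ) φ ψ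

theorem denseRange_toH : DenseRange (toH hL μ) :=
  UniformSpace.Completion.denseRange_coe (α := PreDirac hL μ)

theorem exists_seq_tendsto_toH (Ψ : DiracHilbert hL μ) :
    ∃ u : ℕ → 𝓢(Conf n, ℂ), Tendsto (fun m => toH hL μ (u m)) atTop (𝓝 Ψ) := by
  obtain ⟨x, hx, hlim⟩ := mem_closure_iff_seq_limit.1 (denseRange_toH hL μ Ψ)
  choose u hu using hx
  exact ⟨u, by simpa only [hu] using hlim⟩

theorem eq_of_inner_toH {Ψ Ψ' : DiracHilbert hL μ}
    (h : ∀ χ, inner ℂ (toH hL μ χ) Ψ = inner ℂ (toH hL μ χ) Ψ') : Ψ = Ψ' := by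
  refine Dense.eq_of_inner_right (𝕜 := ℂ) (denseRange_toH hL μ) ?_
  rintro _ ⟨χ, rfl⟩
  exact h χ

theorem norm_toH_sq (φ : 𝓢(Conf n, ℂ)) : ‖toH hL μ φ‖ ^ 2 = ‖algInner μ φ φ‖ := by
  rw [← inner_toH hL, inner_self_eq_norm_sq_to_K]
  simp

theorem toH_weyl (X : L) (φ : 𝓢(Conf n, ℂ)) :
    toH hL μ (weyl (X : Phase n) φ) = toH hL μ φ :=
  eq_of_inner_toH hL μ fun χ => by rw [inner_toH, inner_toH, algInner_weyl_right μ hL]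

theorem norm_toH_weyl {Z : Phase n} (hZ : Z ∈ sympOrth L) (φ : 𝓢(Conf n, ℂ)) :
    ‖toH hL μ (weyl Z φ)‖ = ‖toH hL μ φ‖ := by
  have h := norm_toH_sq hL μ (weyl Z φ)
  rw [algInner_weyl_weyl μ hZ, ← norm_toH_sq hL] at h
  exact (pow_left_inj₀ (norm_nonneg _) (norm_nonneg _) two_ne_zero).1 h

/-- The distribution that a vector of the Hilbert space defines. -/
def diracPairing (Ψ : DiracHilbert hL μ) (χ : 𝓢(Conf n, ℂ)) : ℂ :=
  inner ℂ (toH hL μ (conjS χ)) Ψ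

theorem etaMap_eq_diracPairing (ψ χ : 𝓢(Conf n, ℂ)) :
    etaMap μ ψ χ = diracPairing hL μ (toH hL μ ψ) χ := by
  rw [etaMap_eq_algInner, diracPairing, inner_toH]

/-- The extension of `η` to the completion is injective, since Schwartz functions are dense there.
-/
theorem eq_of_diracPairing {Ψ Ψ' : DiracHilbert hL μ}
    (h : ∀ χ, diracPairing hL μ Ψ χ = diracPairing hL μ Ψ' χ) : Ψ = Ψ' :=
  eq_of_inner_toH hL μ fun χ => by simpa [diracPairing, conjS_conjS] using h (conjS χ)

theorem tendsto_diracPairing {u : ℕ → 𝓢(Conf n, ℂ)} {Ψ : DiracHilbert hL μ}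
    (hu : Tendsto (fun m => toH hL μ (u m)) atTop (𝓝 Ψ)) (χ : 𝓢(Conf n, ℂ)) :
    Tendsto (fun m => diracPairing hL μ (toH hL μ (u m)) χ) atTop (𝓝 (diracPairing hL μ Ψ χ)) :=
  tendsto_const_nhds.inner hu

/-- A fundamental sequence converges in the Hilbert space, and the distribution that it represents
is the one that its limit defines. -/
theorem Represents.exists_vector {u : ℕ → 𝓢(Conf n, ℂ)} {ψD : 𝓢'(Conf n, ℂ)}
    (h : Represents μ u ψD) : ∃ Ψ : DiracHilbert hL μ,
      Tendsto (fun m => toH hL μ (u m)) atTop (𝓝 Ψ) ∧ ∀ χ, ψD χ = diracPairing hL μ Ψ χ := by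
  have hc : CauchySeq fun m => toH hL μ (u m) := by
    refine Metric.cauchySeq_iff.2 fun ε hε => ?_
    obtain ⟨M, hM⟩ := h.1 (ε ^ 2) (by positivity)
    refine ⟨M, fun m hm l hl => ?_⟩
    have := hM m hm l hl
    rw [← norm_toH_sq hL, map_sub, ← dist_eq_norm] at this
    exact lt_of_pow_lt_pow_left₀ 2 hε.le this
  obtain ⟨Ψ, hΨ⟩ := cauchySeq_tendsto_of_complete hc
  refine ⟨Ψ, hΨ, fun χ => tendsto_nhds_unique (h.2 χ) ?_⟩
  simpa only [etaMap_eq_diracPairing hL] using tendsto_diracPairing hL μ hΨ χ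

/-- By injectivity every sequence representing `ψD` converges to the same `Ψ`, and the inner product
is continuous. -/
theorem isDiracInnerSelf_of_vector {ψD : 𝓢'(Conf n, ℂ)} (hψ : ψD ∈ diracSpace μ)
    {Ψ : DiracHilbert hL μ} (hΨ : ∀ χ, ψD χ = diracPairing hL μ Ψ χ) :
    IsDiracInnerSelf μ ψD (inner ℂ Ψ Ψ) := by
  refine ⟨hψ, fun u hu => ?_⟩
  obtain ⟨Ψ', hlim, hΨ'⟩ := hu.exists_vector hL μ
  have h : Ψ' = Ψ := eq_of_diracPairing hL μ fun χ => by rw [← hΨ, ← hΨ']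
  rw [← h]
  have h' := Filter.Tendsto.inner (𝕜 := ℂ) hlim hlim
  simpa only [inner_toH] using h'

end Completion

/-! ### Pairing a vector with a Schwartz family -/

section PairingFamilies

variable {n k : ℕ} {L : Submodule ℝ (Phase n)}
  {V : Type*} [NormedAddCommGroup V] [NormedSpace ℝ V] [FiniteDimensional ℝ V]

theorem exists_matrixElement_conj_family (L : Submodule ℝ (Phase n)) (φ : 𝓢(Conf n, ℂ))
    (K : 𝓢(V × Conf n, ℂ)) : ∃ Φ : 𝓢(L × V, ℂ), ∀ (X : L) v,
      Φ (X, v) = innerS (conjS (slice K v)) (weyl (X : Phase n) φ) := by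
  obtain ⟨K', hK'⟩ := exists_conj_schwartz K
  obtain ⟨K₂, hK₂⟩ := exists_const_family φ
  obtain ⟨Φ, hΦ⟩ := exists_matrixElement_family_restrict L K' K₂
  obtain ⟨Φ', hΦ'⟩ := SchwartzMap.exists_comp_injective Φ
    (LinearMap.id.prodMap (LinearMap.inl ℝ V (Fin 0 → ℝ)))
    (Function.injective_id.prodMap LinearMap.inl_injective)
  refine ⟨Φ', fun X v => ?_⟩
  have h : slice K' v = conjS (slice K v) := by
    ext η
    simp [hK', conjS_apply]
  rw [hΦ', ← h, ← hK₂ 0, ← hΦ]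
  rfl

theorem innerS_conjS_slice (K : 𝓢(V × Conf n, ℂ)) (v : V) (φ : 𝓢(Conf n, ℂ)) :
    innerS (conjS (slice K v)) φ = ∫ η, K (v, η) * φ η := by
  simp [innerS, conjS_apply]

theorem fderiv_matrixElement_conj_family (φ : 𝓢(Conf n, ℂ)) (K : 𝓢(V × Conf n, ℂ)) (v w : V) :
    fderiv ℝ (fun v => innerS (conjS (slice K v)) φ) v w =
      innerS (conjS (slice (LineDeriv.lineDerivOp ((w, 0) : V × Conf n) K) v)) φ := by
  have hg : (fun z : Conf n × V => φ z.1).HasTemperateGrowth :=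
    φ.hasTemperateGrowth.comp (ContinuousLinearMap.fst ℝ (Conf n) V).hasTemperateGrowth
  obtain ⟨K', hK'⟩ := SchwartzMap.exists_comp_injective K
    (LinearEquiv.prodComm ℝ (Conf n) V).toLinearMap (LinearEquiv.prodComm ℝ (Conf n) V).injective
  obtain ⟨f, hf⟩ := exists_temperate_mul hg K'
  have hf' : ∀ η v, f (η, v) = K (v, η) * φ η := fun η v => by
    rw [hf, hK', mul_comm]
    rfl
  have h := SchwartzMap.fderiv_partialIntegral volume f v w
  simp only [hf'] at h
  simp only [innerS_conjS_slice]
  rw [h]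
  refine integral_congr_ae (.of_forall fun η => ?_)
  beta_reduce
  rw [SchwartzMap.lineDerivOp_apply_eq_fderiv, SchwartzMap.lineDerivOp_apply_eq_fderiv]
  have h1 : HasFDerivAt (fun v => f (η, v))
      (fderiv ℝ f (η, v) ∘L ContinuousLinearMap.inr ℝ (Conf n) V) v :=
    (f.hasFDerivAt (η, v)).comp v (hasFDerivAt_prodMk_right η v)
  have h2 : HasFDerivAt (fun v => K (v, η) * φ η)
      ((φ η) • (fderiv ℝ K (v, η) ∘L ContinuousLinearMap.inl ℝ V (Conf n))) v :=
    ((K.hasFDerivAt (v, η)).comp v (hasFDerivAt_prodMk_left v η)).mul_const _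
  simp only [hf'] at h1
  have := DFunLike.congr_fun (h1.unique h2) w
  simpa [mul_comm] using this

variable (hL : IsIsotropicPlane k L) (μ : Measure L) [μ.IsAddHaarMeasure]

theorem diracPairing_toH (φ χ : 𝓢(Conf n, ℂ)) :
    diracPairing hL μ (toH hL μ φ) χ = algInner μ (conjS χ) φ := by
  rw [diracPairing, inner_toH]

/-- The pairing of a Schwartz function with a Schwartz family is a Schwartz function, and it may
be differentiated under the pairing. -/
theorem exists_diracPairing_toH_slice (φ : 𝓢(Conf n, ℂ)) (K : 𝓢(V × Conf n, ℂ)) :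
    ∃ Γ : 𝓢(V, ℂ), (∀ v, Γ v = diracPairing hL μ (toH hL μ φ) (slice K v)) ∧
      ∀ v w, fderiv ℝ Γ v w = diracPairing hL μ (toH hL μ φ)
        (slice (LineDeriv.lineDerivOp ((w, 0) : V × Conf n) K) v) := by
  obtain ⟨Φ, hΦ⟩ := exists_matrixElement_conj_family L φ K
  obtain ⟨Γ, hΓ⟩ := SchwartzMap.exists_partialIntegral μ Φ
  refine ⟨Γ, fun v => ?_, fun v w => ?_⟩
  · rw [hΓ, diracPairing_toH, algInner]
    simp only [hΦ]
  · have : (Γ : V → ℂ) = fun v => ∫ X, Φ (X, v) ∂μ := funext hΓ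
    rw [this, SchwartzMap.fderiv_partialIntegral, diracPairing_toH, algInner]
    refine integral_congr_ae (.of_forall fun X => ?_)
    beta_reduce
    rw [← fderiv_matrixElement_conj_family, SchwartzMap.lineDerivOp_apply_eq_fderiv]
    simp only [← hΦ]
    have h1 : HasFDerivAt (fun v => Φ (X, v))
        (fderiv ℝ Φ (X, v) ∘L ContinuousLinearMap.inr ℝ L V) v :=
      (Φ.hasFDerivAt (X, v)).comp v (hasFDerivAt_prodMk_right X v)
    rw [h1.fderiv]
    simp

/-- The squared norm is the diagonal of a Schwartz function of two parameters; this gives bounds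
uniform, and integrable, in the parameter. -/
theorem exists_norm_toH_slice_sq (K : 𝓢(V × Conf n, ℂ)) :
    ∃ Θ : 𝓢(V, ℂ), ∀ v, ‖toH hL μ (conjS (slice K v))‖ ^ 2 = ‖Θ v‖ := by
  obtain ⟨K', hK'⟩ := exists_conj_schwartz K
  have h : ∀ v, slice K' v = conjS (slice K v) := fun v => by
    ext η
    simp [hK', conjS_apply]
  obtain ⟨Φ, hΦ⟩ := exists_matrixElement_family_restrict L K' K'
  obtain ⟨Γ, hΓ⟩ := SchwartzMap.exists_partialIntegral μ Φ
  obtain ⟨Θ, hΘ⟩ := SchwartzMap.exists_comp_injective Γ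
    (LinearMap.id.prod LinearMap.id : V →ₗ[ℝ] V × V) fun x y h => congrArg Prod.fst h
  refine ⟨Θ, fun v => ?_⟩
  rw [norm_toH_sq, ← h, hΘ, hΓ, algInner]
  simp only [← hΦ]
  rfl

/-- The vectors of a Schwartz family are bounded. -/
theorem exists_norm_toH_slice_le (K : 𝓢(V × Conf n, ℂ)) :
    ∃ C, 0 ≤ C ∧ ∀ v, ‖toH hL μ (conjS (slice K v))‖ ≤ C := by
  obtain ⟨Θ, hΘ⟩ := exists_norm_toH_slice_sq hL μ K
  refine ⟨Real.sqrt (SchwartzMap.seminorm ℝ 0 0 Θ), Real.sqrt_nonneg _, fun v => ?_⟩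
  refine Real.le_sqrt_of_sq_le ?_
  rw [hΘ]
  exact SchwartzMap.norm_le_seminorm ℝ Θ v

/-- The norms of the vectors of a Schwartz family have an integrable majorant. -/
theorem exists_integrable_norm_toH_slice_le [MeasurableSpace V] [BorelSpace V] (ν : Measure V)
    [ν.IsAddHaarMeasure] (K : 𝓢(V × Conf n, ℂ)) :
    ∃ b : V → ℝ, Integrable b ν ∧ ∀ v, ‖toH hL μ (conjS (slice K v))‖ ≤ b v := by
  obtain ⟨Θ, hΘ⟩ := exists_norm_toH_slice_sq hL μ K
  let l := ν.integrablePower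
  let C := 2 ^ (2 * l) * ((Finset.Iic (2 * l, 0)).sup
    (fun m => SchwartzMap.seminorm ℝ m.1 m.2)) Θ
  refine ⟨fun v => Real.sqrt C * (1 + ‖v‖) ^ (-(l : ℝ)),
    (Measure.integrable_pow_neg_integrablePower ν).const_mul _, fun v => ?_⟩
  have h := SchwartzMap.one_add_le_sup_seminorm_apply (𝕜 := ℝ) (m := (2 * l, 0)) (k := 2 * l)
    (n := 0) le_rfl le_rfl Θ v
  rw [norm_iteratedFDeriv_zero, ← hΘ] at h
  have h1 : 0 < 1 + ‖v‖ := by positivity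
  beta_reduce
  rw [Real.rpow_neg h1.le, Real.rpow_natCast, ← div_eq_mul_inv, le_div_iff₀ (by positivity)]
  refine Real.le_sqrt_of_sq_le (le_trans (le_of_eq ?_) h)
  ring

theorem norm_diracPairing_le (Ψ : DiracHilbert hL μ) (χ : 𝓢(Conf n, ℂ)) :
    ‖diracPairing hL μ Ψ χ‖ ≤ ‖toH hL μ (conjS χ)‖ * ‖Ψ‖ :=
  norm_inner_le_norm _ _

theorem diracPairing_sub_left (Ψ Ψ' : DiracHilbert hL μ) (χ : 𝓢(Conf n, ℂ)) :
    diracPairing hL μ (Ψ - Ψ') χ = diracPairing hL μ Ψ χ - diracPairing hL μ Ψ' χ :=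
  inner_sub_right _ _ _

/-- For Schwartz approximants the derivative passes to the family `K`. These derivatives converge
uniformly in `v`, because the differentiated families are bounded in `H`. -/
theorem hasFDerivAt_diracPairing_slice (Ψ : DiracHilbert hL μ) (K : 𝓢(V × Conf n, ℂ)) (v : V) :
    HasFDerivAt (fun v => diracPairing hL μ Ψ (slice K v))
      (∑ i, (LinearMap.toContinuousLinearMap ((Module.finBasis ℝ V).coord i)).smulRight
        (diracPairing hL μ Ψ (slice (LineDeriv.lineDerivOp
          ((Module.finBasis ℝ V i, 0) : V × Conf n) K) v))) v := by
  obtain ⟨u, hu⟩ := exists_seq_tendsto_toH hL μ Ψ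
  choose Γ hΓ hΓ' using fun m => exists_diracPairing_toH_slice hL μ (u m) K
  let b := Module.finBasis ℝ V
  let ℓ : Fin (Module.finrank ℝ V) → V →L[ℝ] ℝ := fun i =>
    LinearMap.toContinuousLinearMap (b.coord i)
  let D : Fin (Module.finrank ℝ V) → 𝓢(V × Conf n, ℂ) := fun i =>
    LineDeriv.lineDerivOp ((b i, 0) : V × Conf n) K
  choose C hC0 hC using fun i => exists_norm_toH_slice_le hL μ (D i)
  refine hasFDerivAt_of_tendstoUniformly (l := atTop) (f := fun m => Γ m)
    (g' := fun v => ∑ i, (ℓ i).smulRight (diracPairing hL μ Ψ (slice (D i) v)))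
    (f' := fun m => fderiv ℝ (Γ m)) ?_ (fun m v => (Γ m).hasFDerivAt v)
    (fun v => ?_) v
  · rw [Metric.tendstoUniformly_iff]
    intro ε hε
    have hlim : Tendsto (fun m => (∑ i, ‖ℓ i‖ * C i) * ‖Ψ - toH hL μ (u m)‖) atTop (𝓝 0) := by
      have h := ((tendsto_const_nhds (x := Ψ)).sub hu).norm.const_mul (∑ i, ‖ℓ i‖ * C i)
      simpa using h
    filter_upwards [hlim.eventually (gt_mem_nhds hε)] with m hm v
    refine lt_of_le_of_lt ?_ hm
    have e : fderiv ℝ (Γ m) v =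
        ∑ i, (ℓ i).smulRight (diracPairing hL μ (toH hL μ (u m)) (slice (D i) v)) := by
      ext w
      have h : fderiv ℝ (Γ m) v w = fderiv ℝ (Γ m) v (∑ i, b.repr w i • b i) := by
        rw [b.sum_repr w]
      rw [h, map_sum]
      simp only [map_smul]
      simp only [hΓ']
      simp [ℓ, D, b]
    rw [e, dist_eq_norm, ← Finset.sum_sub_distrib, Finset.sum_mul]
    refine (norm_sum_le _ _).trans (Finset.sum_le_sum fun i _ => ?_)
    have e2 : (ℓ i).smulRight (diracPairing hL μ Ψ (slice (D i) v)) -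
        (ℓ i).smulRight (diracPairing hL μ (toH hL μ (u m)) (slice (D i) v)) =
        (ℓ i).smulRight (diracPairing hL μ (Ψ - toH hL μ (u m)) (slice (D i) v)) := by
      ext w
      simp [diracPairing_sub_left, mul_sub]
    rw [e2, ContinuousLinearMap.norm_smulRight_apply, mul_assoc]
    gcongr
    refine (norm_diracPairing_le ..).trans ?_
    gcongr
    exact hC i v
  · simp only [hΓ]
    exact tendsto_diracPairing hL μ hu _

/-- The pairing of a vector with a Schwartz family is a Schwartz function. -/
theorem exists_diracPairing_slice (Ψ : DiracHilbert hL μ) (K : 𝓢(V × Conf n, ℂ)) :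
    ∃ Γ : 𝓢(V, ℂ), ∀ v, Γ v = diracPairing hL μ Ψ (slice K v) := by
  refine exists_schwartz_of_class
    (𝒞 := {g | ∃ K : 𝓢(V × Conf n, ℂ), g = fun v => diracPairing hL μ Ψ (slice K v)})
    ?_ ?_ ?_ ⟨K, rfl⟩
  · rintro _ ⟨K, rfl⟩
    obtain ⟨C, -, hC⟩ := exists_norm_toH_slice_le hL μ K
    refine ⟨C * ‖Ψ‖, fun v => (norm_diracPairing_le ..).trans ?_⟩
    gcongr
    exact hC v
  · rintro _ ⟨K, rfl⟩ ℓ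
    obtain ⟨K', hK'⟩ := SchwartzMap.exists_linear_mul K (ℓ ∘L ContinuousLinearMap.fst ℝ V (Conf n))
    refine ⟨K', funext fun v => ?_⟩
    have h : conjS (slice K' v) = (ℓ v : ℂ) • conjS (slice K v) := by
      ext η
      simp [conjS_apply, hK']
    simp only [diracPairing, h, map_smul, inner_smul_left, Complex.conj_ofReal]
  · rintro _ ⟨K, rfl⟩
    refine ⟨fun v => (hasFDerivAt_diracPairing_slice hL μ Ψ K v).differentiableAt, fun w =>
      ⟨LineDeriv.lineDerivOp ((w, 0) : V × Conf n) K, funext fun v => ?_⟩⟩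
    obtain ⟨u, hu⟩ := exists_seq_tendsto_toH hL μ Ψ
    have h1 := fun φ => hasFDerivAt_diracPairing_slice hL μ (toH hL μ φ) K v
    rw [(hasFDerivAt_diracPairing_slice hL μ Ψ K v).fderiv]
    refine tendsto_nhds_unique ?_ (tendsto_diracPairing hL μ hu _)
    -- Linearity in the direction `w` is known for Schwartz `φ`, where both sides are derivatives of
    -- one function; it then passes to the limit.
    have h2 : ∀ φ, diracPairing hL μ (toH hL μ φ)
        (slice (LineDeriv.lineDerivOp ((w, 0) : V × Conf n) K) v) =
        ∑ i, (Module.finBasis ℝ V).coord i w • diracPairing hL μ (toH hL μ φ)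
          (slice (LineDeriv.lineDerivOp ((Module.finBasis ℝ V i, 0) : V × Conf n) K) v) := by
      intro φ
      obtain ⟨Γ, hΓ, hΓ'⟩ := exists_diracPairing_toH_slice hL μ φ K
      rw [← hΓ', show (Γ : V → ℂ) = fun v => diracPairing hL μ (toH hL μ φ) (slice K v) from
        funext hΓ, (h1 φ).fderiv]
      simp
    simp only [h2]
    simp only [sum_apply, ContinuousLinearMap.smulRight_apply,
      LinearMap.coe_toContinuousLinearMap']
    exact tendsto_finsetSum _ fun i _ => (tendsto_diracPairing hL μ hu _).const_smul _

/-- Integration of a Schwartz family commutes with the pairing. -/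
theorem integral_diracPairing_slice [MeasurableSpace V] [BorelSpace V] (ν : Measure V)
    [ν.IsAddHaarMeasure] (Ψ : DiracHilbert hL μ) (K : 𝓢(V × Conf n, ℂ)) (J : 𝓢(Conf n, ℂ))
    (hJ : ∀ η, J η = ∫ v, K (v, η) ∂ν) :
    ∫ v, diracPairing hL μ Ψ (slice K v) ∂ν = diracPairing hL μ Ψ J := by
  -- For Schwartz vectors this is Fubini; general `Ψ` follows by density and dominated convergence.
  have hφ : ∀ φ, ∫ v, diracPairing hL μ (toH hL μ φ) (slice K v) ∂ν =
      diracPairing hL μ (toH hL μ φ) J := by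
    intro φ
    obtain ⟨Φ, hΦ⟩ := exists_matrixElement_conj_family L φ K
    have hΦi : Integrable (Function.uncurry fun (v : V) (X : L) => Φ (X, v)) (ν.prod μ) :=
      (integrable_prod_schwartz μ ν Φ).swap
    obtain ⟨K', hK'⟩ := exists_conj_schwartz K
    have h : ∀ v, slice K' v = conjS (slice K v) := fun v => by
      ext η
      simp [hK', conjS_apply]
    have hJ' : ∀ η, conjS J η = ∫ v, K' (v, η) ∂ν := fun η => by
      simp only [conjS_apply, hJ, hK']
      exact integral_conj.symm
    simp only [diracPairing_toH, algInner, ← hΦ]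
    rw [integral_integral_swap hΦi]
    refine integral_congr_ae (.of_forall fun X => ?_)
    beta_reduce
    simp only [hΦ, ← h]
    rw [← innerS_conj_symm, ← integral_innerS_slice ν _ _ K' hJ', ← integral_conj]
    simp only [innerS_conj_symm]
  obtain ⟨u, hu⟩ := exists_seq_tendsto_toH hL μ Ψ
  refine tendsto_nhds_unique ?_ (tendsto_diracPairing hL μ hu J)
  simp only [← hφ]
  obtain ⟨b, hb, hKb⟩ := exists_integrable_norm_toH_slice_le hL μ ν K
  obtain ⟨C, hC⟩ := (hu.norm.bddAbove_range)
  refine tendsto_integral_of_dominated_convergence (fun v => b v * C) (fun m => ?_)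
    (hb.mul_const C) (fun m => .of_forall fun v => ?_)
    (.of_forall fun v => tendsto_diracPairing hL μ hu _)
  · obtain ⟨Γ, hΓ⟩ := exists_diracPairing_slice hL μ (toH hL μ (u m)) K
    exact (Γ.continuous.aestronglyMeasurable).congr (.of_forall hΓ)
  · refine (norm_diracPairing_le ..).trans ?_
    have : ‖toH hL μ (u m)‖ ≤ C := hC ⟨m, rfl⟩
    have h0 := (norm_nonneg _).trans (hKb v)
    gcongr
    exact hKb v

end PairingFamilies

/-! ### Smeared Weyl operators map the distribution of a vector to a Schwartz function -/

section Smearing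

variable {n k : ℕ} {L : Submodule ℝ (Phase n)}

instance isAddHaarMeasure_volume_phase : (volume : Measure (Phase n)).IsAddHaarMeasure := by
  rw [Measure.volume_eq_prod]
  infer_instance

/-- The reflection `(P, Q) ↦ (P, -Q)` of the phase space. -/
def phaseReflection (n : ℕ) : Phase n →ₗ[ℝ] Phase n :=
  LinearMap.id.prodMap (-LinearMap.id)

@[simp]
theorem phaseReflection_apply (Y : Phase n) : phaseReflection n Y = (Y.1, -Y.2) := rfl

/-- The Weyl integral kernel of a smeared Weyl operator. -/
theorem exists_smearing_kernel (F : 𝓢(Phase n, ℂ)) :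
    ∃ K : 𝓢(Conf n × Conf n, ℂ), ∀ v ξ, K (v, ξ) = ∫ P, Complex.exp (Complex.I *
      ((dotp P ((2 : ℝ)⁻¹ • (v + ξ)) : ℝ) : ℂ)) * F (P, v - ξ) := by
  obtain ⟨J, hJ⟩ := SchwartzMap.exists_partialFourier (P := Conf n) volume (innerSL ℝ)
    (fun ℓ => ⟨(InnerProductSpace.toDual ℝ (Conf n)).symm ℓ, fun p => by
      rw [innerSL_apply_apply, real_inner_comm, InnerProductSpace.toDual_symm_apply]⟩) F
  let T : Conf n × Conf n →ₗ[ℝ] Conf n × Conf n :=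
    ((2 : ℝ)⁻¹ • (LinearMap.fst ℝ (Conf n) (Conf n) + LinearMap.snd ℝ (Conf n) (Conf n))).prod
      (LinearMap.fst ℝ (Conf n) (Conf n) - LinearMap.snd ℝ (Conf n) (Conf n))
  have hT : Function.Injective T := by
    refine (injective_iff_map_eq_zero T).2 fun z hz => ?_
    have h1 : (2 : ℝ)⁻¹ • (z.1 + z.2) = 0 := congrArg Prod.fst hz
    have h2 : z.1 - z.2 = 0 := congrArg Prod.snd hz
    have h3 : z.1 = z.2 := sub_eq_zero.1 h2
    have h4 : z.2 = 0 := by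
      rw [h3, ← two_smul ℝ, smul_smul] at h1
      simpa using h1
    exact Prod.ext (h3.trans h4) h4
  obtain ⟨K, hK⟩ := SchwartzMap.exists_comp_injective J T hT
  refine ⟨K, fun v ξ => ?_⟩
  rw [hK]
  change J ((2 : ℝ)⁻¹ • (v + ξ), v - ξ) = _
  rw [hJ]
  refine integral_congr_ae (.of_forall fun P => ?_)
  beta_reduce
  rw [innerSL_apply_apply, dotp_eq_inner, real_inner_comm]

theorem integral_weyl_reflection (F : 𝓢(Phase n, ℂ)) (χ : 𝓢(Conf n, ℂ))
    (Kχ : 𝓢(Phase n × Conf n, ℂ)) (K : 𝓢(Conf n × Conf n, ℂ))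
    (hKχ : ∀ Y, slice Kχ Y = F Y • weyl (phaseReflection n Y) χ)
    (hK : ∀ v ξ, K (v, ξ) = ∫ P, Complex.exp (Complex.I *
      ((dotp P ((2 : ℝ)⁻¹ • (v + ξ)) : ℝ) : ℂ)) * F (P, v - ξ)) (ξ : Conf n) :
    ∫ Y, Kχ (Y, ξ) = ∫ v, χ v * K (v, ξ) := by
  have hi : Integrable (fun Y => Kχ (Y, ξ)) ((volume : Measure (Conf n)).prod volume) :=
    SchwartzMap.integrable_slice_left (volume : Measure (Phase n)) Kχ ξ
  rw [Measure.volume_eq_prod, integral_prod_symm _ hi,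
    -- The substitution `v = ξ + Q` turns `P·ξ + P·Q/2` into `P` paired with the midpoint of `v` and
    -- `ξ`.
    ← integral_add_left_eq_self (fun v => χ v * K (v, ξ)) ξ]
  refine integral_congr_ae (.of_forall fun Q => ?_)
  beta_reduce
  rw [hK, ← integral_const_mul]
  refine integral_congr_ae (.of_forall fun P => ?_)
  beta_reduce
  rw [← slice_apply, hKχ, smul_apply, weyl_apply, phaseReflection_apply, smul_eq_mul, weylPhase,
    sub_neg_eq_add, add_sub_cancel_left]
  have h : dotp P ξ - dotp P (-Q) / 2 = dotp P ((2 : ℝ)⁻¹ • (ξ + Q + ξ)) := by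
    simp only [dotp_eq_inner, inner_neg_right, real_inner_smul_right, inner_add_right]
    ring
  rw [h]
  ring

variable (hL : IsIsotropicPlane k L) (μ : Measure L) [μ.IsAddHaarMeasure]

theorem diracPairing_smul (Ψ : DiracHilbert hL μ) (c : ℂ) (χ : 𝓢(Conf n, ℂ)) :
    diracPairing hL μ Ψ (c • χ) = c * diracPairing hL μ Ψ χ := by
  have h : conjS (c • χ) = (starRingEnd ℂ) c • conjS χ := by
    ext η
    simp [conjS_apply]
  simp only [diracPairing, h, map_smul, inner_smul_left, Complex.conj_conj]

/-- Smearing with a Schwartz function turns the distribution of a vector into a Schwartz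
function. -/
theorem exists_isSmeared {Ψ : DiracHilbert hL μ} {ψD : 𝓢'(Conf n, ℂ)}
    (hΨ : ∀ χ, ψD χ = diracPairing hL μ Ψ χ) (F : 𝓢(Phase n, ℂ)) :
    ∃ g : 𝓢(Conf n, ℂ), IsSmeared ψD F g := by
  obtain ⟨K, hK⟩ := exists_smearing_kernel F
  obtain ⟨g, hg⟩ := exists_diracPairing_slice hL μ Ψ K
  refine ⟨g, fun χ => ?_⟩
  obtain ⟨Kχ, hKχ⟩ := exists_weyl_family F (phaseReflection n) χ
  have hY : ∀ Y, F Y * weylDistr Y ψD χ = diracPairing hL μ Ψ (slice Kχ Y) := fun Y => by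
    rw [hKχ, diracPairing_smul, weylDistr, hΨ, phaseReflection_apply]
  obtain ⟨Γ, hΓ⟩ := exists_diracPairing_slice hL μ Ψ Kχ
  simp only [hY]
  refine ⟨(Γ.integrable (μ := volume)).congr (.of_forall hΓ), ?_⟩
  obtain ⟨J, hJ⟩ := SchwartzMap.exists_partialIntegral (volume : Measure (Phase n)) Kχ
  have hg' : (fun z : Conf n × Conf n => χ z.1).HasTemperateGrowth :=
    χ.hasTemperateGrowth.comp (ContinuousLinearMap.fst ℝ (Conf n) (Conf n)).hasTemperateGrowth
  obtain ⟨K', hK'⟩ := exists_temperate_mul hg' K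
  have hs : ∀ v, slice K' v = χ v • slice K v := fun v => by
    ext η
    simp [hK']
  -- The same function `J` is the integral of two families, over `Y` and over `v`; both sides equal
  -- the pairing of `Ψ` with `J`.
  rw [integral_diracPairing_slice hL μ volume Ψ Kχ J hJ,
    ← integral_diracPairing_slice hL μ volume Ψ K' J fun ξ => by
      rw [hJ, integral_weyl_reflection F χ Kχ K hKχ hK]
      simp only [hK']]
  refine integral_congr_ae (.of_forall fun v => ?_)
  beta_reduce
  rw [hs, diracPairing_smul, hg, mul_comm]

end Smearing

/-! ### Integrating phases over the plane localizes on `L^⊥` -/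

section Splitting

variable {n k : ℕ} {L G : Submodule ℝ (Phase n)}

/-- Integrating a Schwartz function on the phase space against the phases of a plane, and then over
the plane, gives its integral over the symplectic orthogonal complement. -/
theorem integral_integral_phase (hL : IsIsotropicPlane k L) (hG : IsGaugeSurface k L G)
    (μ : Measure L) (σ : Measure G) [σ.IsAddHaarMeasure] (ν : Measure (sympOrth L))
    [ν.IsAddHaarMeasure]
    (hν : Measure.map (fun p : G × sympOrth L => (p.1 : Phase n) + (p.2 : Phase n))
      (σ.prod ν) = volume) (Δ : ℝ)
    (hΔ : ∀ ρ : 𝓢(G, ℂ), ∫ X : L, (∫ Y : G,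
      ρ Y * Complex.exp (Complex.I * (symp (X : Phase n) (Y : Phase n) : ℂ)) ∂σ) ∂μ
        = ρ 0 * (Δ : ℂ)) (Θ : 𝓢(Phase n, ℂ)) :
    ∫ X : L, (∫ Y, Complex.exp (Complex.I * (symp (X : Phase n) Y : ℂ)) * Θ Y) ∂μ =
      Δ * ∫ z : sympOrth L, Θ z ∂ν := by
  let e := G.prodEquivOfIsCompl (sympOrth L) (hG.isCompl_sympOrth hL)
  have he : ∀ p : G × sympOrth L, e p = (p.1 : Phase n) + (p.2 : Phase n) := fun p => by
    simp [e]
  obtain ⟨Θ', hΘ'⟩ := SchwartzMap.exists_comp_injective Θ e.toLinearMap e.injective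
  obtain ⟨Θ'', hΘ''⟩ := SchwartzMap.exists_comp_injective Θ'
    (LinearEquiv.prodComm ℝ (sympOrth L) G).toLinearMap
    (LinearEquiv.prodComm ℝ (sympOrth L) G).injective
  obtain ⟨ρ, hρ⟩ := SchwartzMap.exists_partialIntegral ν Θ''
  have hval : ∀ x z, Θ' (x, z) = Θ ((x : Phase n) + (z : Phase n)) := fun x z => by
    rw [hΘ']
    exact congrArg Θ (he (x, z))
  have hρ' : ∀ x, ρ x = ∫ z, Θ' (x, z) ∂ν := fun x => by
    rw [hρ]
    refine integral_congr_ae (.of_forall fun z => ?_)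
    beta_reduce
    rw [hΘ'']
    rfl
  have hme : MeasurableEmbedding
      (fun p : G × sympOrth L => (p.1 : Phase n) + (p.2 : Phase n)) := by
    have h : (fun p : G × sympOrth L => (p.1 : Phase n) + (p.2 : Phase n)) =
        e.toContinuousLinearEquiv := funext fun p => (he p).symm
    rw [h]
    exact e.toContinuousLinearEquiv.toHomeomorph.measurableEmbedding
  -- The phase ignores the `L^⊥`-component, so that component integrates out into `ρ`, and `ρ 0` is
  -- the integral over `L^⊥`.
  have hX : ∀ X : L, ∫ Y, Complex.exp (Complex.I * (symp (X : Phase n) Y : ℂ)) * Θ Y =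
      ∫ Y : G, ρ Y * Complex.exp (Complex.I * (symp (X : Phase n) (Y : Phase n) : ℂ)) ∂σ := by
    intro X
    rw [← hν, hme.integral_map]
    have e1 : ∀ p : G × sympOrth L,
        Complex.exp (Complex.I * (symp (X : Phase n) ((p.1 : Phase n) + (p.2 : Phase n)) : ℂ)) *
          Θ ((p.1 : Phase n) + (p.2 : Phase n)) =
        Complex.exp (Complex.I * (symp (X : Phase n) (p.1 : Phase n) : ℂ)) * Θ' p := fun p => by
      rw [symp_add_right, p.2.2 X X.2, add_zero, ← hval]
    simp only [e1]
    have hi : Integrable (fun p : G × sympOrth L =>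
        Complex.exp (Complex.I * (symp (X : Phase n) (p.1 : Phase n) : ℂ)) * Θ' p)
        (σ.prod ν) := by
      refine (integrable_prod_schwartz σ ν Θ').mono (Continuous.aestronglyMeasurable ?_)
        (.of_forall fun p => ?_)
      · have h1 := Θ'.continuous
        have h2 : Continuous fun p : G × sympOrth L => symp (X : Phase n) (p.1 : Phase n) :=
          (sympL n (X : Phase n)).continuous.comp (by fun_prop)
        fun_prop
      · rw [norm_mul, SchwartzMap.norm_cexp_I_mul_ofReal, one_mul]
    rw [integral_prod _ hi]
    refine integral_congr_ae (.of_forall fun x => ?_)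
    beta_reduce
    rw [hρ', mul_comm (integral _ _)]
    exact integral_const_mul (Complex.exp (Complex.I * (symp (X : Phase n) (x : Phase n) : ℂ)))
      fun z => Θ' (x, z)
  simp only [hX]
  rw [hΔ, hρ', mul_comm]
  congr 1
  refine integral_congr_ae (.of_forall fun z => ?_)
  beta_reduce
  rw [hval, Submodule.coe_zero, zero_add]

end Splitting

/-! ### Matrix elements and their limits on `L^⊥` -/

section MatrixElement

variable {n k : ℕ} {L G : Submodule ℝ (Phase n)} (hL : IsIsotropicPlane k L) (μ : Measure L)
  [μ.IsAddHaarMeasure]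

/-- The matrix element `(ψ_D, exp (i Ω(Y)) ψ_D)` between a Schwartz function and a vector of the
Hilbert space. -/
def vectorMatrixElement (φ : 𝓢(Conf n, ℂ)) (Ψ : DiracHilbert hL μ) (Y : Phase n) : ℂ :=
  inner ℂ (toH hL μ (weyl (-Y) φ)) Ψ

theorem diracPairing_weyl_reflection (Ψ : DiracHilbert hL μ) (χ : 𝓢(Conf n, ℂ)) (Y : Phase n) :
    diracPairing hL μ Ψ (weyl (Y.1, -Y.2) χ) = vectorMatrixElement hL μ (conjS χ) Ψ Y := by
  rw [diracPairing, conjS_weyl, vectorMatrixElement]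

theorem exists_mul_vectorMatrixElement (F : 𝓢(Phase n, ℂ)) (φ : 𝓢(Conf n, ℂ))
    (Ψ : DiracHilbert hL μ) :
    ∃ Θ : 𝓢(Phase n, ℂ), ∀ Y, Θ Y = F Y * vectorMatrixElement hL μ φ Ψ Y := by
  obtain ⟨K, hK⟩ := exists_weyl_family F (phaseReflection n) (conjS φ)
  obtain ⟨Θ, hΘ⟩ := exists_diracPairing_slice hL μ Ψ K
  refine ⟨Θ, fun Y => ?_⟩
  rw [hΘ, hK, diracPairing_smul, phaseReflection_apply, diracPairing_weyl_reflection, conjS_conjS]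

theorem continuous_vectorMatrixElement (φ : 𝓢(Conf n, ℂ)) (Ψ : DiracHilbert hL μ) :
    Continuous (vectorMatrixElement hL μ φ Ψ) := by
  refine continuous_iff_continuousAt.2 fun Y => ?_
  obtain ⟨F, hF⟩ := exists_schwartz_eq_one_nhds Y
  obtain ⟨Θ, hΘ⟩ := exists_mul_vectorMatrixElement hL μ F φ Ψ
  refine Θ.continuous.continuousAt.congr (hF.mono fun Z hZ => ?_)
  rw [hΘ, hZ, one_mul]

/-- `exp (-iΩ(X))` acts trivially on `H`, so once it is moved to the outside only the commutation
phase remains. -/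
theorem vectorMatrixElement_weyl (X : L) (φ : 𝓢(Conf n, ℂ)) (Ψ : DiracHilbert hL μ)
    (Y : Phase n) : vectorMatrixElement hL μ (weyl (-(X : Phase n)) φ) Ψ Y =
      Complex.exp (Complex.I * (symp (X : Phase n) Y : ℂ)) * vectorMatrixElement hL μ φ Ψ Y := by
  have h := toH_weyl hL μ (-X) (weyl (-Y) φ)
  rw [Submodule.coe_neg] at h
  rw [vectorMatrixElement, vectorMatrixElement, weyl_swap, map_smul, inner_smul_left, h,
    ← Complex.exp_conj, map_mul, Complex.conj_I, Complex.conj_ofReal, symp_neg_left,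
    symp_neg_right, neg_neg, symp_swap Y]
  congr 2
  push_cast
  ring

/-- The inner product of a Schwartz function with a smeared Dirac state. -/
theorem algInner_of_isSmeared (hG : IsGaugeSurface k L G) (σ : Measure G) [σ.IsAddHaarMeasure]
    (ν : Measure (sympOrth L)) [ν.IsAddHaarMeasure]
    (hν : Measure.map (fun p : G × sympOrth L => (p.1 : Phase n) + (p.2 : Phase n))
      (σ.prod ν) = volume) (Δ : ℝ)
    (hΔ : ∀ ρ : 𝓢(G, ℂ), ∫ X : L, (∫ Y : G,
      ρ Y * Complex.exp (Complex.I * (symp (X : Phase n) (Y : Phase n) : ℂ)) ∂σ) ∂μ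
        = ρ 0 * (Δ : ℂ)) {Ψ : DiracHilbert hL μ} {ψD : 𝓢'(Conf n, ℂ)}
    (hΨ : ∀ χ, ψD χ = diracPairing hL μ Ψ χ) {F : 𝓢(Phase n, ℂ)} {g : 𝓢(Conf n, ℂ)}
    (hg : IsSmeared ψD F g) (φ : 𝓢(Conf n, ℂ)) :
    algInner μ φ g = Δ * ∫ z : sympOrth L, F z * vectorMatrixElement hL μ φ Ψ z ∂ν := by
  obtain ⟨Θ, hΘ⟩ := exists_mul_vectorMatrixElement hL μ F φ Ψ
  have h := integral_integral_phase hL hG μ σ ν hν Δ hΔ Θ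
  simp only [hΘ] at h
  rw [← h, algInner]
  refine integral_congr_ae (.of_forall fun X => ?_)
  beta_reduce
  -- `exp (iΩ(X))` is moved from `g` to `φ`; the result is the test function for the smearing
  -- identity.
  have h1 := (hg (conjS (weyl (-(X : Phase n)) φ))).2
  rw [integral_mul_eq_innerS, conjS_conjS] at h1
  rw [innerS_weyl_right, h1]
  refine integral_congr_ae (.of_forall fun Y => ?_)
  beta_reduce
  rw [weylDistr, hΨ, diracPairing_weyl_reflection, conjS_conjS, vectorMatrixElement_weyl]
  ring

/-- Uniformity in `z` comes from the isometric action of `L^⊥` on `H`; it lets the first argument be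
extended to `Ψ` itself. -/
theorem norm_vectorMatrixElement_le (φ : 𝓢(Conf n, ℂ)) (Ψ : DiracHilbert hL μ)
    (z : sympOrth L) : ‖vectorMatrixElement hL μ φ Ψ z‖ ≤ ‖toH hL μ φ‖ * ‖Ψ‖ := by
  refine (norm_inner_le_norm _ _).trans ?_
  rw [norm_toH_weyl hL μ ((sympOrth L).neg_mem z.2)]

/-- The matrix element of a vector on the symplectic orthogonal complement of the plane. -/
theorem exists_limit_vectorMatrixElement {u : ℕ → 𝓢(Conf n, ℂ)} {Ψ : DiracHilbert hL μ}
    (hu : Tendsto (fun m => toH hL μ (u m)) atTop (𝓝 Ψ)) :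
    ∃ B : sympOrth L → ℂ, Continuous B ∧ (∀ z, ‖B z‖ ≤ ‖Ψ‖ * ‖Ψ‖) ∧ B 0 = inner ℂ Ψ Ψ ∧
      ∀ z : sympOrth L,
        Tendsto (fun m => vectorMatrixElement hL μ (u m) Ψ z) atTop (𝓝 (B z)) := by
  have hdist : ∀ m l (z : sympOrth L), dist (vectorMatrixElement hL μ (u m) Ψ z)
      (vectorMatrixElement hL μ (u l) Ψ z) ≤ dist (toH hL μ (u m)) (toH hL μ (u l)) * ‖Ψ‖ := by
    intro m l z
    have h := norm_vectorMatrixElement_le hL μ (u m - u l) Ψ z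
    simpa only [vectorMatrixElement, map_sub, inner_sub_left, ← dist_eq_norm] using h
  have hc := hu.cauchySeq
  have hunif : ∀ ε > 0, ∃ N, ∀ m ≥ N, ∀ l ≥ N, ∀ z : sympOrth L,
      dist (vectorMatrixElement hL μ (u m) Ψ z) (vectorMatrixElement hL μ (u l) Ψ z) < ε := by
    intro ε hε
    -- The `+ 1` covers the case `Ψ = 0`.
    obtain ⟨N, hN⟩ := Metric.cauchySeq_iff.1 hc (ε / (‖Ψ‖ + 1)) (by positivity)
    refine ⟨N, fun m hm l hl z => ?_⟩
    have h1 := hN m hm l hl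
    rw [lt_div_iff₀ (by positivity)] at h1
    have h2 := hdist m l z
    have h3 : 0 ≤ dist (toH hL μ (u m)) (toH hL μ (u l)) := dist_nonneg
    nlinarith
  have hlim : ∀ z : sympOrth L, ∃ b,
      Tendsto (fun m => vectorMatrixElement hL μ (u m) Ψ z) atTop (𝓝 b) := fun z =>
    cauchySeq_tendsto_of_complete (Metric.cauchySeq_iff.2 fun ε hε =>
      (hunif ε hε).imp fun N hN m hm l hl => hN m hm l hl z)
  choose B hB using hlim
  refine ⟨B, ?_, fun z => ?_, ?_, hB⟩
  · have hU : TendstoUniformly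
        (fun m (z : sympOrth L) => vectorMatrixElement hL μ (u m) Ψ z) B atTop := by
      refine tendstoUniformlyOn_univ.1 (UniformCauchySeqOn.tendstoUniformlyOn_of_tendsto ?_
        fun z _ => hB z)
      refine Metric.uniformCauchySeqOn_iff.2 fun ε hε => ?_
      exact (hunif ε hε).imp fun N hN m hm l hl z _ => hN m hm l hl z
    exact hU.continuous (.of_forall fun m =>
      (continuous_vectorMatrixElement hL μ (u m) Ψ).comp continuous_subtype_val)
  · exact le_of_tendsto_of_tendsto (hB z).norm (hu.norm.mul_const ‖Ψ‖)
      (.of_forall fun m => norm_vectorMatrixElement_le hL μ (u m) Ψ z)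
  · refine tendsto_nhds_unique (hB 0) ?_
    have h : Tendsto (fun m => inner ℂ (toH hL μ (u m)) Ψ) atTop (𝓝 (inner ℂ Ψ Ψ)) :=
      Filter.Tendsto.inner (𝕜 := ℂ) hu tendsto_const_nhds
    simpa [vectorMatrixElement, weyl_zero] using h

end MatrixElement

/-! ### Distributions carried by a plane -/

section BoundedDensity

variable {n : ℕ} {M : Submodule ℝ (Phase n)}

/-- A bounded continuous density on a plane defines a tempered distribution on the phase space. -/
theorem exists_distribution_of_density (ν : Measure M) [ν.IsAddHaarMeasure] {B : M → ℂ}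
    (hB : Continuous B) {C : ℝ} (hC : ∀ z, ‖B z‖ ≤ C) :
    ∃ R : 𝓢'(Phase n, ℂ), ∀ F, R F = ∫ z, F z * B z ∂ν := by
  have hL : MemLp B ⊤ ν := memLp_top_of_bound hB.aestronglyMeasurable C (.of_forall hC)
  obtain ⟨K, -, hK⟩ := M.subtype.exists_antilipschitzWith (LinearMap.ker_eq_bot.2
    M.subtype_injective)
  let T : 𝓢(Phase n, ℂ) →L[ℂ] 𝓢(M, ℂ) :=
    SchwartzMap.compCLMOfAntilipschitz ℂ (g := M.subtype) M.subtypeL.hasTemperateGrowth hK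
  refine ⟨PointwiseConvergenceCLM.precomp _ T
    (MeasureTheory.Lp.toTemperedDistribution hL.toLp), fun F => ?_⟩
  change (MeasureTheory.Lp.toTemperedDistribution hL.toLp) (T F) = _
  rw [MeasureTheory.Lp.toTemperedDistribution_apply]
  refine integral_congr_ae ?_
  filter_upwards [hL.coeFn_toLp] with z hz
  rw [hz]
  rfl

end BoundedDensity

/-! ### Restriction to the gauge surface and the conclusion -/

section Restriction

variable {n k : ℕ} {L G M : Submodule ℝ (Phase n)}

/-- A distribution with a continuous density on a complement of a plane has a restriction to that
plane, a multiple of the delta distribution. -/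
theorem isRestriction_of_density (hM : IsCompl G M) (σ : Measure G) [σ.IsAddHaarMeasure]
    (ν : Measure M) [ν.IsAddHaarMeasure]
    (hν : Measure.map (fun p : G × M => (p.1 : Phase n) + (p.2 : Phase n)) (σ.prod ν) = volume)
    {B : M → ℂ} (hB : Continuous B) {R : 𝓢'(Phase n, ℂ)} (hR : ∀ F, R F = ∫ z, F z * B z ∂ν) :
    IsRestriction R G σ (B 0 • TemperedDistribution.delta 0) := by
  intro N ν' hN _ hν' f
  obtain ⟨τ, g, hg⟩ := exists_complement_equiv hN hM
  have hτ := map_complement_equiv σ volume ν' ν hν' hν τ g hg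
  -- The point `τ y` of `M` has components `-g y ∈ G` and `y ∈ N`, so the density of `R_f` on all of
  -- `N` is `f (-g y) * B (τ y)`. At `y = 0` this is `f 0 * B 0`, whichever `N` is taken.
  refine ⟨Set.univ, univ_mem, fun y => f (-g y) * B (τ y), Continuous.continuousOn ?_, ?_,
    fun χ _ _ F hF => ?_⟩
  · have := f.continuous
    have := τ.continuous
    fun_prop
  · beta_reduce
    rw [map_zero, map_zero, neg_zero]
    exact mul_comm _ _
  · have hme : MeasurableEmbedding τ := τ.toHomeomorph.measurableEmbedding
    rw [hR, ← hτ, hme.integral_map]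
    refine integral_congr_ae (.of_forall fun y => ?_)
    have h : ((τ y : M) : Phase n) = ((-g y : G) : Phase n) + (y : Phase n) := by
      rw [hg y, Submodule.coe_neg, neg_add_cancel_left]
    beta_reduce
    rw [h, hF]
    ring

/-- The matrix element of a Dirac state is a bounded continuous density on the symplectic
orthogonal complement of the plane. -/
theorem exists_matrixElement_density (hL : IsIsotropicPlane k L) (hG : IsGaugeSurface k L G)
    (μ : Measure L) [μ.IsAddHaarMeasure] (σ : Measure G) [σ.IsAddHaarMeasure]
    (ν : Measure (sympOrth L)) [ν.IsAddHaarMeasure]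
    (hν : Measure.map (fun p : G × sympOrth L => (p.1 : Phase n) + (p.2 : Phase n))
      (σ.prod ν) = volume) (Δ : ℝ)
    (hΔ : ∀ ρ : 𝓢(G, ℂ), ∫ X : L, (∫ Y : G,
      ρ Y * Complex.exp (Complex.I * (symp (X : Phase n) (Y : Phase n) : ℂ)) ∂σ) ∂μ
        = ρ 0 * (Δ : ℂ)) {Ψ : DiracHilbert hL μ} {ψD : 𝓢'(Conf n, ℂ)}
    (hΨ : ∀ χ, ψD χ = diracPairing hL μ Ψ χ) :
    ∃ R : 𝓢'(Phase n, ℂ), IsMatrixElement ψD ψD R ∧ ∃ B : sympOrth L → ℂ, Continuous B ∧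
      B 0 = Δ * inner ℂ Ψ Ψ ∧ ∀ F, R F = ∫ z, F z * B z ∂ν := by
  obtain ⟨u, hu⟩ := exists_seq_tendsto_toH hL μ Ψ
  obtain ⟨B, hBc, hBn, hB0, hBu⟩ := exists_limit_vectorMatrixElement hL μ hu
  have hBc' : Continuous fun z => (Δ : ℂ) * B z := by fun_prop
  obtain ⟨R, hR⟩ := exists_distribution_of_density ν hBc' (C := |Δ| * (‖Ψ‖ * ‖Ψ‖)) fun z => by
    rw [norm_mul, Complex.norm_real, Real.norm_eq_abs]
    exact mul_le_mul_of_nonneg_left (hBn z) (abs_nonneg Δ)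
  refine ⟨R, fun F => ?_, _, hBc', by rw [hB0], hR⟩
  obtain ⟨g, hg⟩ := exists_isSmeared hL μ hΨ F
  refine ⟨g, hg, ?_⟩
  rw [hΨ, diracPairing, conjS_conjS, inner_conj_symm]
  -- `R F` is `⟨Ψ, g⟩` in `H`. Approximating the left `Ψ` by Schwartz functions makes the formula
  -- for smeared states available, and its limit brings in `B`.
  have h1 : Tendsto (fun m => algInner μ (u m) g) atTop (𝓝 (inner ℂ Ψ (toH hL μ g))) := by
    have h := Filter.Tendsto.inner (𝕜 := ℂ) hu (tendsto_const_nhds (x := toH hL μ g))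
    simpa only [inner_toH] using h
  refine tendsto_nhds_unique ?_ h1
  simp only [algInner_of_isSmeared hL μ hG σ ν hν Δ hΔ hΨ hg]
  have h2 : R F = Δ * ∫ z : sympOrth L, F z * B z ∂ν := by
    rw [hR, ← integral_const_mul]
    refine integral_congr_ae (.of_forall fun z => ?_)
    beta_reduce
    ring
  rw [h2]
  refine Tendsto.const_mul _ ?_
  obtain ⟨F', hF'⟩ := SchwartzMap.exists_comp_injective F (sympOrth L).subtype
    (sympOrth L).subtype_injective
  obtain ⟨C, hC⟩ := hu.norm.bddAbove_range
  refine tendsto_integral_of_dominated_convergence (fun z => ‖F' z‖ * (C * ‖Ψ‖)) (fun m => ?_)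
    ((F'.integrable (μ := ν)).norm.mul_const _) (fun m => .of_forall fun z => ?_)
    (.of_forall fun z => (hBu z).const_mul _)
  · refine Continuous.aestronglyMeasurable ?_
    have h3 := F.continuous
    have h4 := continuous_vectorMatrixElement hL μ (u m) Ψ
    fun_prop
  · have h3 : ‖toH hL μ (u m)‖ ≤ C := hC ⟨m, rfl⟩
    have h4 : F z = F' z := (hF' z).symm
    rw [norm_mul, h4]
    gcongr
    refine (norm_vectorMatrixElement_le hL μ (u m) Ψ z).trans ?_
    gcongr

end Restriction

theorem lemma8 (n k : ℕ) (L G : Submodule ℝ (Phase n))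
    (hL : IsIsotropicPlane k L) (hG : IsGaugeSurface k L G)
    (μ : Measure L) [μ.IsAddHaarMeasure] (σ : Measure G) [σ.IsAddHaarMeasure] :
    ∃ Δ : ℝ, 0 < Δ ∧
      (∀ ρ : 𝓢(G, ℂ),
        (∀ X : L, Integrable (fun Y : G =>
          ρ Y * Complex.exp (Complex.I * (symp (X : Phase n) (Y : Phase n) : ℂ))) σ) ∧
        Integrable (fun X : L => ∫ Y : G,
          ρ Y * Complex.exp (Complex.I * (symp (X : Phase n) (Y : Phase n) : ℂ)) ∂σ) μ ∧
        ∫ X : L, (∫ Y : G,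
          ρ Y * Complex.exp (Complex.I * (symp (X : Phase n) (Y : Phase n) : ℂ)) ∂σ) ∂μ
          = ρ 0 * (Δ : ℂ)) ∧
      (∀ ψD ∈ diracSpace μ,
        ∃ R : 𝓢'(Phase n, ℂ), IsMatrixElement ψD ψD R ∧
          ∃ S : 𝓢'(G, ℂ), IsRestriction R G σ S ∧
            ∀ ρ : 𝓢(G, ℂ), ρ 0 = 1 / (Δ : ℂ) → IsDiracInnerSelf μ ψD (S ρ)) := by
  obtain ⟨Δ, hpos, hΔ⟩ := hG.exists_inversion hL μ σ
  refine ⟨Δ, hpos, hΔ, fun ψD hψD => ?_⟩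
  obtain ⟨u, hu⟩ := hψD
  obtain ⟨Ψ, -, hΨ⟩ := hu.exists_vector hL μ
  have hM := hG.isCompl_sympOrth hL
  obtain ⟨ν, _, hν⟩ := exists_measure_map_add_eq hM σ (volume : Measure (Phase n))
  obtain ⟨R, hR, B, hB, hB0, hRB⟩ := exists_matrixElement_density hL hG μ σ ν hν Δ
    (fun ρ => (hΔ ρ).2.2) hΨ
  refine ⟨R, hR, _, isRestriction_of_density hM σ ν hν hB hRB, fun ρ hρ => ?_⟩
  -- `B 0` carries the factor `Δ`, which the normalization of `ρ` cancels.
  have h : (B 0 • TemperedDistribution.delta (0 : G)) ρ = inner ℂ Ψ Ψ := by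
    change B 0 * ρ 0 = _
    have hΔ0 : (Δ : ℂ) ≠ 0 := by exact_mod_cast hpos.ne'
    rw [hB0, hρ]
    field_simp
  rw [h]
  exact isDiracInnerSelf_of_vector hL μ ⟨u, hu⟩ hΨ

end
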